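/- Let $\mathcal X,\mathcal Y$ be finite nonempty sets and $P_{XY}$ a probability distribution on $\mathcal X\times\mathcal Y$ with marginals $P_X,P_Y$. All logarithms and entropies are to base $2$. For a distribution $P$ on a finite set $\mathcal A$, $n\ge 1$ and $\delta\in\mathbb R$, let $T^n_\delta(P)$ be the set of $a^n\in\mathcal A^n$ such that for every $a\in\mathcal A$ the number $N(a|a^n)$ of occurrences of $a$ in $a^n$ satisfies $|\frac1n N(a|a^n)-P(a)|\le\delta$, and $N(a|a^n)=0$ whenever $P(a)=0$. Let $(\epsilon_{1n}),(\epsilon_{2n}),(\lambda_n)$ be real sequences that tend to $0$ and satisfy $\sqrt n\,\epsilon_{1n}\to\infty$, $\sqrt n\,\epsilon_{2n}\to\infty$, $\sqrt n\,\lambda_n\to\infty$. The typicality graph $G_n=G_n(\epsilon_{1n},\epsilon_{2n},\lambda_n)$ is the bipartite graph with left vertex set $T^n_{\epsilon_{1n}}(P_X)$ and right vertex set $T^n_{\epsilon_{2n}}(P_Y)$, in which $x^n$ and $y^n$ are adjacent iff the sequence of pairs $(x^n,y^n)$ lies in $T^n_{\lambda_n}(P_{XY})$. A sequence of (not necessarily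 induced) subgraphs $\Gamma_n$ of $G_n$, with sets of left and right vertices $V_X(\Gamma_n)$ and $V_Y(\Gamma_n)$, is called nearly complete of rates $(R_X,R_Y)\in\mathbb R^2$ with slack $(\delta_n)$ if $\delta_n\to0$ and, for all sufficiently large $n$ (with $\log 0=-\infty$), 1. $\left|\frac1n\log|V_X(\Gamma_n)|-R_X\right|\le\delta_n$ and $\left|\frac1n\log|V_Y(\Gamma_n)|-R_Y\right|\le\delta_n$; 2. $\frac1n\log\deg_{\Gamma_n}(x^n)\ge R_Y-\delta_n$ for every $x^n\in V_X(\Gamma_n)$; 3. $\frac1n\log\deg_{\Gamma_n}(y^n)\ge R_X-\delta_n$ for every $y^n\in V_Y(\Gamma_n)$. Let $\mathcal C$ be the set of all $(R_X,R_Y)$ with $0\le R_X\le H(X|U)$ and $0\le R_Y\le H(Y|U)$ for some conditional distribution $P_{U|XY}$ of a random variable $U$ with finite alphabet such that $X-U-Y$ is a Markov chain under $P_{XY}P_{U|XY}$. **Proposition.** 1. (Achievability) For every $(R_X,R_Y)\in\mathcal C$ there are a sequence $(\delta_n)$ and a sequence of nearly complete subgraphs $\Gamma_n$ of $G_n$ of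 rates $(R_X,R_Y)$ with slack $(\delta_n)$. 2. (Converse) If $(\Gamma_n)$ is a sequence of nearly complete subgraphs of $G_n$ of rates $(R_X,R_Y)$ with slack $(\delta_n)$, and $\delta_n\log n\to0$, then $(R_X,R_Y)\in\mathcal C$. -/

import Mathlib

open Filter Topology

namespace TypicalityGraph

noncomputable section

/-- `N(a|x)`: the number of occurrences of the letter `a` in the sequence `x` of length `n`. -/
def letterCount {A : Type*} {n : ℕ} (a : A) (x : Fin n → A) : ℕ :=
  Set.ncard {i : Fin n | x i = a}

/-- The set `T^n_δ(P)` of sequences of length `n` that are typical for the distribution `P` with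
constant `δ`: every empirical frequency is within `δ` of its probability, and no letter of
probability zero occurs. -/
def typicalSet {A : Type*} (P : A → ℝ) (δ : ℝ) (n : ℕ) : Set (Fin n → A) :=
  {x | (∀ a, |(letterCount a x : ℝ) / n - P a| ≤ δ) ∧ ∀ a, P a = 0 → letterCount a x = 0}

/-- The marginal of the first component. -/
def margFst {A B : Type*} [Fintype B] (P : A × B → ℝ) : A → ℝ := fun a => ∑ b, P (a, b)

/-- The marginal of the second component. -/
def margSnd {A B : Type*} [Fintype A] (P : A × B → ℝ) : B → ℝ := fun b => ∑ a, P (a, b)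

/-- The typicality graph on sequences of length `n`: a bipartite graph whose left vertices are the
`ε₁`-typical `X`-sequences, whose right vertices are the `ε₂`-typical `Y`-sequences, and in which a
left and a right vertex are adjacent iff the pair of sequences is jointly typical with constant
`lam`. -/
def typicalityGraph {X Y : Type*} [Fintype X] [Fintype Y] (P : X × Y → ℝ) (ε₁ ε₂ lam : ℝ) (n : ℕ) :
    SimpleGraph (typicalSet (margFst P) ε₁ n ⊕ typicalSet (margSnd P) ε₂ n) where
  Adj
    | .inl x, .inr y => (fun i => (x.1 i, y.1 i)) ∈ typicalSet P lam n
    | .inr y, .inl x => (fun i => (x.1 i, y.1 i)) ∈ typicalSet P lam n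
    | _, _ => False
  symm := ⟨by rintro (x | y) (x' | y') h <;> exact h⟩
  loopless := ⟨by rintro (x | y) h <;> exact h⟩

/-- The left vertices of a subgraph of a graph on a disjoint union. -/
def leftVerts {V W : Type*} {G : SimpleGraph (V ⊕ W)} (Γ : G.Subgraph) : Set V :=
  {x | Sum.inl x ∈ Γ.verts}

/-- The right vertices of a subgraph of a graph on a disjoint union. -/
def rightVerts {V W : Type*} {G : SimpleGraph (V ⊕ W)} (Γ : G.Subgraph) : Set W :=
  {y | Sum.inr y ∈ Γ.verts}

/-- The degree of a vertex in the subgraph `Γ`. -/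
def subDegree {V : Type*} {G : SimpleGraph V} (Γ : G.Subgraph) (v : V) : ℕ :=
  (Γ.neighborSet v).ncard

/-- `HasLogRate c n R δ` says `|(1/n) log₂ c - R| ≤ δ`, where `c` is positive
(as `log 0` is `-∞`). -/
def HasLogRate (c n : ℕ) (R δ : ℝ) : Prop :=
  0 < c ∧ |Real.logb 2 c / n - R| ≤ δ

/-- `HasLogRateGE c n R δ` says `(1/n) log₂ c ≥ R - δ`, where `c` is positive
(as `log 0` is `-∞`). -/
def HasLogRateGE (c n : ℕ) (R δ : ℝ) : Prop :=
  0 < c ∧ R - δ ≤ Real.logb 2 c / n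

/-- The conditions on one subgraph, at block length `n`, for near completeness at the rates
`(RX, RY)` with slack `δ`. -/
structure IsNearlyComplete {V W : Type*} {G : SimpleGraph (V ⊕ W)} (Γ : G.Subgraph) (n : ℕ)
    (RX RY δ : ℝ) : Prop where
  left_size : HasLogRate (leftVerts Γ).ncard n RX δ
  right_size : HasLogRate (rightVerts Γ).ncard n RY δ
  left_degree : ∀ x ∈ leftVerts Γ, HasLogRateGE (subDegree Γ (Sum.inl x)) n RY δ
  right_degree : ∀ y ∈ rightVerts Γ, HasLogRateGE (subDegree Γ (Sum.inr y)) n RX δ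

/-- `Γ n`, a subgraph of the `n`-th typicality graph for each `n`, is a sequence of nearly complete
subgraphs of rates `(RX, RY)` with slack sequence `δ`. -/
def IsNearlyCompleteSeq {X Y : Type*} [Fintype X] [Fintype Y] (P : X × Y → ℝ) (ε₁ ε₂ lam : ℕ → ℝ)
    (Γ : ∀ n, (typicalityGraph P (ε₁ n) (ε₂ n) (lam n) n).Subgraph) (RX RY : ℝ) (δ : ℕ → ℝ) : Prop :=
  Tendsto δ atTop (𝓝 0) ∧ ∀ᶠ n in atTop, IsNearlyComplete (Γ n) n RX RY (δ n)

/-- The set of rate pairs of sequences of nearly complete subgraphs contained in the sequence of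
typicality graphs. -/
def nearlyCompleteRates {X Y : Type*} [Fintype X] [Fintype Y] (P : X × Y → ℝ)
    (ε₁ ε₂ lam : ℕ → ℝ) : Set (ℝ × ℝ) :=
  {R | ∃ (Γ : ∀ n, (typicalityGraph P (ε₁ n) (ε₂ n) (lam n) n).Subgraph) (δ : ℕ → ℝ),
    IsNearlyCompleteSeq P ε₁ ε₂ lam Γ R.1 R.2 δ}

/-- The delta convention for a sequence of typicality constants. -/
def DeltaConvention (ε : ℕ → ℝ) : Prop :=
  Tendsto ε atTop (𝓝 0) ∧ Tendsto (fun n : ℕ => √(n : ℝ) * ε n) atTop atTop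

/-- The conditional entropy `H(A|B)`, in bits, of a pair with joint distribution `Q`. -/
def condEntropy {A B : Type*} [Fintype A] [Fintype B] (Q : A × B → ℝ) : ℝ :=
  -∑ a, ∑ b, Q (a, b) * Real.logb 2 (Q (a, b) / margSnd Q b)

/-- The joint distribution of `(X, U)` induced by `P = P_{XY}` and `K = P_{U|XY}`. -/
def jointXU {X Y U : Type*} [Fintype Y] (P : X × Y → ℝ) (K : X × Y → U → ℝ) : X × U → ℝ :=
  fun a => ∑ y, P (a.1, y) * K (a.1, y) a.2

/-- The joint distribution of `(Y, U)` induced by `P = P_{XY}` and `K = P_{U|XY}`. -/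
def jointYU {X Y U : Type*} [Fintype X] (P : X × Y → ℝ) (K : X × Y → U → ℝ) : Y × U → ℝ :=
  fun b => ∑ x, P (x, b.1) * K (x, b.1) b.2

/-- The distribution of `U` induced by `P = P_{XY}` and `K = P_{U|XY}`. -/
def distU {X Y U : Type*} [Fintype X] [Fintype Y] (P : X × Y → ℝ) (K : X × Y → U → ℝ) : U → ℝ :=
  fun u => ∑ z, P z * K z u

/-- `X - U - Y` is a Markov chain: `X` and `Y` are conditionally independent given `U`, that is,
`P(x, y, u) P(u) = P(x, u) P(y, u)` for all `x`, `y`, `u`. -/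
def IsMarkovXUY {X Y U : Type*} [Fintype X] [Fintype Y] (P : X × Y → ℝ) (K : X × Y → U → ℝ) :
    Prop :=
  ∀ x y u, (P (x, y) * K (x, y) u) * distU P K u = jointXU P K (x, u) * jointYU P K (y, u)

/-- The pairs of nonnegative numbers `(RX, RY)` with `RX ≤ H(X|U)` and `RY ≤ H(Y|U)` for some
random variable `U` with a finite alphabet, given by a conditional distribution `P_{U|XY}`, such
that `X - U - Y` is a Markov chain. -/
def markovRegion {X Y : Type*} [Fintype X] [Fintype Y] (P : X × Y → ℝ) : Set (ℝ × ℝ) :=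
  {R | 0 ≤ R.1 ∧ 0 ≤ R.2 ∧ ∃ (U : Type) (_ : Fintype U) (K : X × Y → U → ℝ),
    (∀ z, K z ∈ stdSimplex ℝ U) ∧ IsMarkovXUY P K ∧
      R.1 ≤ condEntropy (jointXU P K) ∧ R.2 ≤ condEntropy (jointYU P K)}

end

end TypicalityGraph

/-!
The rate region is governed by mixtures of product distributions: a variable `U` with `X - U - Y`
amounts to a representation `P = ∑ w(u) q_u ⊗ r_u`, for which `H(X|U) = ∑ w(u) H(q_u)` and
`H(Y|U) = ∑ w(u) H(r_u)` (`IsProductMixture`). Revealing `X` or `Y` with some probability, as a part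
of `U`, lowers either conditional entropy to any prescribed value (`IsProductMixture.mono`), so it
is enough to treat rate pairs that are equal to the pair of conditional entropies.

Achievability is random coding. Draw triples `(u_i, x_i, y_i)` independently from the mixture. By
Chebyshev's inequality all letter frequencies and information densities are close to their means
with high probability; this is where `√n * ε n → ∞` enters. By averaging, this remains true given a
suitable fixed `u`, and given `u` the sequences `x` and `y` are independent. Discarding the `x` and
`y` with too many bad partners (`exists_finset_good_pairs`) leaves sets in which every element has
good partners of at least half of the mass, and the information densities turn masses into
cardinalities (`IsProductMixture.eventually_exists_isNearlyComplete`).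

For the converse, choose an edge `(X^n, Y^n)` of `Γ n` uniformly and put
`U_i = (X_1, Y_1, …, X_{i-1}, Y_{i-1})`. By the chain rule `∑ H(X_i, Y_i | U_i)` is the logarithm of
the number of edges, which is about `n (RX + RY)`, while `∑ H(X_i | U_i) ≤ H(X^n)` and
`∑ H(Y_i | U_i) ≤ H(Y^n)` are at most about `n RX` and `n RY`. So the conditional mutual
informations `I(X_i; Y_i | U_i)` are small on average. To pass to the limit although the alphabets
of the `U_i` grow, one regards the averages over `i` as points of the convex hull of the compact set
of all `(p, H(p_X), H(p_Y), H(p))` (`exists_mem_smul_convexHull_entropyGraph`, proved by induction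
on the number of letters, with sizes of sets in place of entropies of sequences). That hull is
compact by Carathéodory's theorem, and a limit point is a finite convex combination in which
`H(p) = H(p_X) + H(p_Y)` for every `p` of positive weight, that is, a mixture of product
distributions (`isProductMixture_of_mem_convexHull`).
-/

namespace TypicalityGraph

/-! ### Entropy and Gibbs' inequality -/

/-- The entropy `H(p)`, in bits, of a distribution on a finite set. -/
noncomputable def entropy {A : Type*} [Fintype A] (p : A → ℝ) : ℝ :=
  -∑ a, p a * Real.logb 2 (p a)

/-- The image distribution `π_* p`. -/
noncomputable def pushforward {A B : Type*} [Fintype A] [DecidableEq B] (π : A → B) (p : A → ℝ) :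
    B → ℝ :=
  fun b => ∑ a, if π a = b then p a else 0

lemma continuous_entropy {A : Type*} [Fintype A] :
    Continuous (entropy : (A → ℝ) → ℝ) := by
  have h : (entropy : (A → ℝ) → ℝ) = fun p => (∑ a, Real.negMulLog (p a)) / Real.log 2 := by
    funext p
    simp only [entropy, Real.logb, Real.negMulLog, Finset.sum_div, ← Finset.sum_neg_distrib]
    exact Finset.sum_congr rfl fun a _ => by ring
  rw [h]
  fun_prop

lemma margFst_mem_stdSimplex {A B : Type*} [Fintype A] [Fintype B] {p : A × B → ℝ}
    (hp : p ∈ stdSimplex ℝ (A × B)) : margFst p ∈ stdSimplex ℝ A :=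
  ⟨fun _ => Finset.sum_nonneg fun _ _ => hp.1 _, by
    rw [← hp.2, Fintype.sum_prod_type]; rfl⟩

lemma margSnd_mem_stdSimplex {A B : Type*} [Fintype A] [Fintype B] {p : A × B → ℝ}
    (hp : p ∈ stdSimplex ℝ (A × B)) : margSnd p ∈ stdSimplex ℝ B :=
  ⟨fun _ => Finset.sum_nonneg fun _ _ => hp.1 _, by
    rw [← hp.2, Fintype.sum_prod_type_right]; rfl⟩

lemma pushforward_fst {A B : Type*} [Fintype A] [Fintype B] [DecidableEq A] (p : A × B → ℝ) :
    pushforward Prod.fst p = margFst p := by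
  funext a
  simp only [pushforward, margFst, Fintype.sum_prod_type_right]
  exact Finset.sum_congr rfl fun b _ => by simp

lemma pushforward_snd {A B : Type*} [Fintype A] [Fintype B] [DecidableEq B] (p : A × B → ℝ) :
    pushforward Prod.snd p = margSnd p := by
  funext a
  simp only [pushforward, margSnd, Fintype.sum_prod_type]
  exact Finset.sum_congr rfl fun b _ => by simp

lemma sum_pushforward_mul {A B : Type*} [Fintype A] [Fintype B] [DecidableEq B] (π : A → B)
    (p : A → ℝ) (f : B → ℝ) : ∑ b, pushforward π p b * f b = ∑ a, p a * f (π a) := by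
  simp only [pushforward, Finset.sum_mul]
  rw [Finset.sum_comm]
  exact Finset.sum_congr rfl fun a _ => by simp [ite_mul]

lemma pushforward_mem_stdSimplex {A B : Type*} [Fintype A] [Fintype B] [DecidableEq B] (π : A → B)
    {p : A → ℝ} (hp : p ∈ stdSimplex ℝ A) : pushforward π p ∈ stdSimplex ℝ B := by
  refine ⟨fun b => Finset.sum_nonneg fun a _ => ?_, ?_⟩
  · split_ifs
    exacts [hp.1 a, le_rfl]
  · simpa [hp.2] using sum_pushforward_mul π p fun _ => 1

/-- The termwise form of Gibbs' inequality, in nats. -/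
lemma mul_log_sub_log_le {p s : ℝ} (hp : 0 ≤ p) (hs : 0 ≤ s) (hps : 0 < p → 0 < s) :
    p * (Real.log s - Real.log p) ≤ s - p := by
  rcases hp.eq_or_lt with rfl | h
  · simpa using hs
  · rw [← Real.log_div (hps h).ne' h.ne']
    have := mul_le_mul_of_nonneg_left (Real.log_le_sub_one_of_pos (div_pos (hps h) h)) hp
    calc _ ≤ _ := this
      _ = s - p := by field_simp

lemma eq_of_mul_log_sub_log_eq {p s : ℝ} (hp : 0 ≤ p) (hps : 0 < p → 0 < s)
    (h : p * (Real.log s - Real.log p) = s - p) : p = s := by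
  rcases hp.eq_or_lt with rfl | h0
  · simpa using h
  · by_contra hne
    rw [← Real.log_div (hps h0).ne' h0.ne'] at h
    have h1 : s / p ≠ 1 := fun h => hne ((div_eq_one_iff_eq h0.ne').1 h).symm
    have := mul_lt_mul_of_pos_left (Real.log_lt_sub_one_of_pos (div_pos (hps h0) h0) h1) h0
    rw [h] at this
    have h2 : p * (s / p - 1) = s - p := by field_simp
    linarith

lemma entropy_mul_log_two {A : Type*} [Fintype A] (p s : A → ℝ) :
    (entropy p + ∑ a, p a * Real.logb 2 (s a)) * Real.log 2
      = ∑ a, p a * (Real.log (s a) - Real.log (p a)) := by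
  have h2 : Real.log 2 ≠ 0 := (Real.log_pos one_lt_two).ne'
  rw [entropy, ← Finset.sum_neg_distrib, ← Finset.sum_add_distrib, Finset.sum_mul]
  refine Finset.sum_congr rfl fun a _ => ?_
  simp only [Real.logb]
  field_simp
  ring

/-- **Gibbs' inequality**. -/
lemma entropy_add_sum_mul_logb_nonpos {A : Type*} [Fintype A] {p s : A → ℝ}
    (hp : p ∈ stdSimplex ℝ A) (hs : s ∈ stdSimplex ℝ A) (hps : ∀ a, 0 < p a → 0 < s a) :
    entropy p + ∑ a, p a * Real.logb 2 (s a) ≤ 0 := by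
  have h := Finset.sum_le_sum fun a (_ : a ∈ Finset.univ) =>
    mul_log_sub_log_le (hp.1 a) (hs.1 a) (hps a)
  rw [← entropy_mul_log_two, Finset.sum_sub_distrib, hp.2, hs.2, sub_self] at h
  exact nonpos_of_mul_nonpos_left h (Real.log_pos one_lt_two)

/-- The equality case of Gibbs' inequality. -/
lemma eq_of_entropy_add_sum_mul_logb_eq_zero {A : Type*} [Fintype A] {p s : A → ℝ}
    (hp : p ∈ stdSimplex ℝ A) (hs : s ∈ stdSimplex ℝ A) (hps : ∀ a, 0 < p a → 0 < s a)
    (h : entropy p + ∑ a, p a * Real.logb 2 (s a) = 0) : p = s := by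
  have h1 := entropy_mul_log_two p s
  rw [h, zero_mul] at h1
  have h2 : ∑ a, p a * (Real.log (s a) - Real.log (p a)) = ∑ a, (s a - p a) := by
    rw [← h1, Finset.sum_sub_distrib, hp.2, hs.2, sub_self]
  rw [Finset.sum_eq_sum_iff_of_le fun a _ =>
    mul_log_sub_log_le (hp.1 a) (hs.1 a) (hps a)] at h2
  exact funext fun a => eq_of_mul_log_sub_log_eq (hp.1 a) (hps a) (h2 a (Finset.mem_univ a))

/-- The grouping bound: `H(p) + ∑ p log m ≤ log ∑ m`, which is Gibbs' inequality for the
distribution proportional to `m`. -/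
lemma entropy_add_sum_mul_logb_le {A : Type*} [Fintype A] {p m : A → ℝ}
    (hp : p ∈ stdSimplex ℝ A) (hm : ∀ a, 0 ≤ m a) (hpm : ∀ a, 0 < p a → 0 < m a) :
    entropy p + ∑ a, p a * Real.logb 2 (m a) ≤ Real.logb 2 (∑ a, m a) := by
  obtain ⟨a₀, ha₀⟩ : ∃ a, 0 < p a := by
    by_contra! h
    have := Finset.sum_nonpos fun a (_ : a ∈ Finset.univ) => h a
    rw [hp.2] at this
    linarith
  have hM : 0 < ∑ a, m a :=
    Finset.sum_pos' (fun a _ => hm a) ⟨a₀, Finset.mem_univ _, hpm _ ha₀⟩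
  have h := entropy_add_sum_mul_logb_nonpos (s := fun a => m a / ∑ a, m a) hp
    ⟨fun a => div_nonneg (hm a) hM.le, by rw [← Finset.sum_div, div_self hM.ne']⟩
    fun a ha => div_pos (hpm a ha) hM
  have h2 : ∑ a, p a * Real.logb 2 (m a / ∑ a, m a)
      = ∑ a, p a * Real.logb 2 (m a) - Real.logb 2 (∑ a, m a) := by
    rw [← one_mul (Real.logb 2 (∑ a, m a)), ← hp.2, Finset.sum_mul, ← Finset.sum_sub_distrib]
    refine Finset.sum_congr rfl fun a _ => ?_
    rcases (hp.1 a).eq_or_lt with h0 | h0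
    · simp [← h0]
    · rw [Real.logb_div (hpm a h0).ne' hM.ne', mul_sub]
  linarith

lemma prod_mem_stdSimplex {A B : Type*} [Fintype A] [Fintype B] {q : A → ℝ} {r : B → ℝ}
    (hq : q ∈ stdSimplex ℝ A) (hr : r ∈ stdSimplex ℝ B) :
    (fun z : A × B => q z.1 * r z.2) ∈ stdSimplex ℝ (A × B) :=
  ⟨fun z => mul_nonneg (hq.1 _) (hr.1 _), by
    rw [Fintype.sum_prod_type, ← Finset.sum_mul_sum, hq.2, hr.2, one_mul]⟩

lemma margFst_pos_of_pos {A B : Type*} [Fintype B] {p : A × B → ℝ} (hp : ∀ z, 0 ≤ p z)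
    {z : A × B} (hz : 0 < p z) : 0 < margFst p z.1 :=
  Finset.sum_pos' (fun _ _ => hp _) ⟨z.2, Finset.mem_univ _, hz⟩

lemma margSnd_pos_of_pos {A B : Type*} [Fintype A] {p : A × B → ℝ} (hp : ∀ z, 0 ≤ p z)
    {z : A × B} (hz : 0 < p z) : 0 < margSnd p z.2 :=
  Finset.sum_pos' (fun _ _ => hp _) ⟨z.1, Finset.mem_univ _, hz⟩

lemma sum_mul_logb_margFst_mul_margSnd {A B : Type*} [Fintype A] [Fintype B] {p : A × B → ℝ}
    (hp : ∀ z, 0 ≤ p z) :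
    ∑ z, p z * Real.logb 2 (margFst p z.1 * margSnd p z.2)
      = -entropy (margFst p) - entropy (margSnd p) := by
  classical
  have h1 := sum_pushforward_mul Prod.fst p fun a => Real.logb 2 (margFst p a)
  have h2 := sum_pushforward_mul Prod.snd p fun a => Real.logb 2 (margSnd p a)
  rw [pushforward_fst] at h1
  rw [pushforward_snd] at h2
  rw [entropy, entropy, h1, h2, neg_neg, sub_neg_eq_add, ← Finset.sum_add_distrib]
  refine Finset.sum_congr rfl fun z _ => ?_
  rcases (hp z).eq_or_lt with h0 | h0
  · simp [← h0]
  · rw [Real.logb_mul (margFst_pos_of_pos hp h0).ne' (margSnd_pos_of_pos hp h0).ne', mul_add]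

/-- Subadditivity of entropy. -/
lemma entropy_le_add_margins {A B : Type*} [Fintype A] [Fintype B] {p : A × B → ℝ}
    (hp : p ∈ stdSimplex ℝ (A × B)) :
    entropy p ≤ entropy (margFst p) + entropy (margSnd p) := by
  have := entropy_add_sum_mul_logb_nonpos hp
    (prod_mem_stdSimplex (margFst_mem_stdSimplex hp) (margSnd_mem_stdSimplex hp))
    fun z hz => mul_pos (margFst_pos_of_pos hp.1 hz) (margSnd_pos_of_pos hp.1 hz)
  rw [sum_mul_logb_margFst_mul_margSnd hp.1] at this
  linarith

/-- Equality in the subadditivity of entropy forces independence. -/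
lemma eq_mul_margins_of_entropy_eq {A B : Type*} [Fintype A] [Fintype B] {p : A × B → ℝ}
    (hp : p ∈ stdSimplex ℝ (A × B))
    (h : entropy p = entropy (margFst p) + entropy (margSnd p)) (z : A × B) :
    p z = margFst p z.1 * margSnd p z.2 := by
  have := eq_of_entropy_add_sum_mul_logb_eq_zero hp
    (prod_mem_stdSimplex (margFst_mem_stdSimplex hp) (margSnd_mem_stdSimplex hp))
    (fun z hz => mul_pos (margFst_pos_of_pos hp.1 hz) (margSnd_pos_of_pos hp.1 hz))
    (by rw [sum_mul_logb_margFst_mul_margSnd hp.1]; linarith)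
  exact congrFun this z

/-! ### Convex hulls of compact sets -/

lemma sum_extend_zero {ι κ M : Type*} [Fintype ι] [Fintype κ] [AddCommMonoid M] (e : ι ↪ κ)
    (g : ι → M) : ∑ j, Function.extend e g 0 j = ∑ i, g i := by
  rw [← Finset.sum_subset (Finset.subset_univ (Finset.univ.map e)), Finset.sum_map]
  · exact Finset.sum_congr rfl fun i _ => e.injective.extend_apply _ _ _
  · intro j _ hj
    rw [Function.extend_apply' _ _ _ (by simpa using hj)]; rfl

/-- In finite dimension the convex hull of a compact set is compact: by Carathéodory's theorem it is
the image of a compact set of weights and points. -/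
lemma isCompact_convexHull_of_finiteDimensional {E : Type*} [AddCommGroup E] [Module ℝ E]
    [TopologicalSpace E] [IsTopologicalAddGroup E] [ContinuousSMul ℝ E] [FiniteDimensional ℝ E]
    {s : Set E} (hs : IsCompact s) : IsCompact (convexHull ℝ s) := by
  rcases s.eq_empty_or_nonempty with rfl | ⟨x₀, hx₀⟩
  · simp
  let d := Module.finrank ℝ E + 1
  let F : (Fin d → ℝ) × (Fin d → E) → E := fun wz => ∑ i, wz.1 i • wz.2 i
  have hF : Continuous F := by fun_prop
  have hK : IsCompact (stdSimplex ℝ (Fin d) ×ˢ Set.univ.pi fun _ : Fin d => s) :=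
    (isCompact_stdSimplex ℝ _).prod (isCompact_univ_pi fun _ => hs)
  convert hK.image hF
  ext x
  constructor
  · intro hx
    obtain ⟨ι, _, z, w, hz, hind, hw, hw1, rfl⟩ := eq_pos_convex_span_of_mem_convexHull hx
    have hcard : Fintype.card ι ≤ Fintype.card (Fin d) := by
      rw [Fintype.card_fin]
      exact hind.card_le_finrank_succ.trans (Nat.succ_le_succ (Submodule.finrank_le _))
    obtain ⟨e⟩ := Function.Embedding.nonempty_of_card_le hcard
    refine ⟨(Function.extend e w 0, Function.extend e z fun _ => x₀), ⟨⟨fun j => ?_, ?_⟩, ?_⟩, ?_⟩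
    · by_cases hj : ∃ i, e i = j
      · obtain ⟨i, rfl⟩ := hj
        simpa [e.injective.extend_apply] using (hw i).le
      · simp [Function.extend_apply' _ _ _ hj]
    · exact (sum_extend_zero e w).trans hw1
    · intro j _
      by_cases hj : ∃ i, e i = j
      · obtain ⟨i, rfl⟩ := hj
        simpa [e.injective.extend_apply] using hz ⟨i, rfl⟩
      · simpa [Function.extend_apply' _ _ _ hj] using hx₀
    · rw [← sum_extend_zero e fun i => w i • z i]
      refine Finset.sum_congr rfl fun j _ => ?_
      by_cases hj : ∃ i, e i = j
      · obtain ⟨i, rfl⟩ := hj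
        simp [e.injective.extend_apply]
      · simp [Function.extend_apply' _ _ _ hj]
  · rintro ⟨⟨w, z⟩, ⟨hw, hz⟩, rfl⟩
    exact mem_convexHull_of_exists_fintype w z hw.1 hw.2 (fun i => hz i trivial) rfl

/-! ### Mixtures of product distributions and the Markov region -/

/-- `P` is a finite mixture `∑ w(u) q_u ⊗ r_u` of product distributions, with mean entropies
`a = ∑ w(u) H(q_u)` and `b = ∑ w(u) H(r_u)` of the factors. In terms of a variable `U` with
`X - U - Y`, these are `a = H(X|U)` and `b = H(Y|U)`. -/
def IsProductMixture {X Y : Type*} [Fintype X] [Fintype Y] (P : X × Y → ℝ) (a b : ℝ) : Prop :=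
  ∃ (U : Type) (_ : Fintype U) (w : U → ℝ) (q : U → X → ℝ) (r : U → Y → ℝ),
    w ∈ stdSimplex ℝ U ∧ (∀ u, q u ∈ stdSimplex ℝ X) ∧ (∀ u, r u ∈ stdSimplex ℝ Y) ∧
    (∀ x y, P (x, y) = ∑ u, w u * (q u x * r u y)) ∧
    a = ∑ u, w u * entropy (q u) ∧ b = ∑ u, w u * entropy (r u)

lemma condEntropy_eq_sum {A U : Type*} [Fintype A] [Fintype U] {J : A × U → ℝ} {w : U → ℝ}
    {q : U → A → ℝ} (hq : ∀ u, q u ∈ stdSimplex ℝ A) (hJ : ∀ a u, J (a, u) = w u * q u a) :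
    condEntropy J = ∑ u, w u * entropy (q u) := by
  have hm : ∀ u, margSnd J u = w u := fun u => by
    simp only [margSnd, hJ, ← Finset.mul_sum, (hq u).2, mul_one]
  simp only [condEntropy, entropy, hm, hJ]
  rw [Finset.sum_comm, ← Finset.sum_neg_distrib]
  refine Finset.sum_congr rfl fun u _ => ?_
  rw [mul_neg, Finset.mul_sum]
  congr 1
  refine Finset.sum_congr rfl fun a _ => ?_
  rcases eq_or_ne (w u) 0 with h | h
  · simp [h]
  · rw [mul_div_cancel_left₀ _ h, mul_assoc]

lemma IsProductMixture.mem_markovRegion {X Y : Type*} [Fintype X] [Fintype Y] {P : X × Y → ℝ}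
    (hP : P ∈ stdSimplex ℝ (X × Y)) {a b : ℝ} (h : IsProductMixture P a b) (ha : 0 ≤ a)
    (hb : 0 ≤ b) : (a, b) ∈ markovRegion P := by
  classical
  obtain ⟨U, _, w, q, r, hw, hq, hr, hmix, rfl, rfl⟩ := h
  have hnn : ∀ z : X × Y, ∀ u, 0 ≤ w u * (q u z.1 * r u z.2) := fun z u =>
    mul_nonneg (hw.1 u) (mul_nonneg ((hq u).1 _) ((hr u).1 _))
  -- Bayes' rule; where `P z = 0` the conditional distribution is irrelevant, and `w` will do.
  let K : X × Y → U → ℝ := fun z u => if P z = 0 then w u else w u * (q u z.1 * r u z.2) / P z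
  have hPK : ∀ z u, P z * K z u = w u * (q u z.1 * r u z.2) := by
    intro z u
    by_cases hz : P z = 0
    · have h0 := hmix z.1 z.2
      rw [Prod.mk.eta, hz, eq_comm, Finset.sum_eq_zero_iff_of_nonneg fun u _ => hnn z u] at h0
      rw [hz, zero_mul, h0 u (Finset.mem_univ u)]
    · simp only [K, if_neg hz]
      field_simp
  have hX : ∀ x u, jointXU P K (x, u) = w u * q u x := fun x u => by
    simp only [jointXU, hPK, ← Finset.mul_sum, (hr u).2, mul_one]
  have hY : ∀ y u, jointYU P K (y, u) = w u * r u y := fun y u => by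
    simp only [jointYU, hPK, ← Finset.mul_sum, ← Finset.sum_mul, (hq u).2, one_mul]
  have hU : ∀ u, distU P K u = w u := fun u => by
    simp only [distU, hPK, ← Finset.mul_sum]
    rw [(prod_mem_stdSimplex (hq u) (hr u)).2, mul_one]
  refine ⟨ha, hb, U, inferInstance, K, fun z => ?_, fun x y u => ?_,
    (condEntropy_eq_sum hq hX).ge, (condEntropy_eq_sum hr hY).ge⟩
  · by_cases hz : P z = 0
    · simpa only [K, if_pos hz] using hw
    · have hz' : 0 < P z := (hP.1 z).lt_of_ne' hz
      simp only [K, if_neg hz]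
      exact ⟨fun u => div_nonneg (hnn z u) hz'.le, by
        rw [← Finset.sum_div, ← hmix, Prod.mk.eta, div_self hz]⟩
  · rw [hPK, hX, hY, hU]
    ring

lemma exists_isProductMixture_of_mem_markovRegion {X Y : Type*} [Fintype X] [Fintype Y]
    {P : X × Y → ℝ} (hP : P ∈ stdSimplex ℝ (X × Y)) {R : ℝ × ℝ} (hR : R ∈ markovRegion P) :
    ∃ a b, R.1 ≤ a ∧ R.2 ≤ b ∧ IsProductMixture P a b := by
  classical
  obtain ⟨-, -, U, _, K, hK, hM, h1, h2⟩ := hR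
  have hnn : ∀ z u, 0 ≤ P z * K z u := fun z u => mul_nonneg (hP.1 z) ((hK z).1 u)
  have hUX : ∀ u, ∑ x, jointXU P K (x, u) = distU P K u := fun u => by
    simp only [distU, jointXU, Fintype.sum_prod_type]
  have hUY : ∀ u, ∑ y, jointYU P K (y, u) = distU P K u := fun u => by
    simp only [distU, jointYU, Fintype.sum_prod_type_right]
  have hXnn : ∀ x u, 0 ≤ jointXU P K (x, u) := fun x u => Finset.sum_nonneg fun y _ => hnn _ _
  have hYnn : ∀ y u, 0 ≤ jointYU P K (y, u) := fun y u => Finset.sum_nonneg fun x _ => hnn _ _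
  have hUnn : ∀ u, 0 ≤ distU P K u := fun u => Finset.sum_nonneg fun z _ => hnn _ _
  -- The conditional distributions given `u`; for `u` of probability zero any distribution will do.
  let q : U → X → ℝ := fun u =>
    if distU P K u = 0 then margFst P else fun x => jointXU P K (x, u) / distU P K u
  let r : U → Y → ℝ := fun u =>
    if distU P K u = 0 then margSnd P else fun y => jointYU P K (y, u) / distU P K u
  have hq : ∀ u, q u ∈ stdSimplex ℝ X := fun u => by
    by_cases h : distU P K u = 0
    · simpa only [q, if_pos h] using margFst_mem_stdSimplex hP
    · simp only [q, if_neg h]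
      exact ⟨fun x => div_nonneg (hXnn x u) (hUnn u), by rw [← Finset.sum_div, hUX, div_self h]⟩
  have hr : ∀ u, r u ∈ stdSimplex ℝ Y := fun u => by
    by_cases h : distU P K u = 0
    · simpa only [r, if_pos h] using margSnd_mem_stdSimplex hP
    · simp only [r, if_neg h]
      exact ⟨fun y => div_nonneg (hYnn y u) (hUnn u), by rw [← Finset.sum_div, hUY, div_self h]⟩
  have hX : ∀ x u, jointXU P K (x, u) = distU P K u * q u x := fun x u => by
    by_cases h : distU P K u = 0
    · have h0 := hUX u
      rw [h, Finset.sum_eq_zero_iff_of_nonneg fun x _ => hXnn x u] at h0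
      rw [h0 x (Finset.mem_univ x), h, zero_mul]
    · simp only [q, if_neg h]
      field_simp
  have hY : ∀ y u, jointYU P K (y, u) = distU P K u * r u y := fun y u => by
    by_cases h : distU P K u = 0
    · have h0 := hUY u
      rw [h, Finset.sum_eq_zero_iff_of_nonneg fun y _ => hYnn y u] at h0
      rw [h0 y (Finset.mem_univ y), h, zero_mul]
    · simp only [r, if_neg h]
      field_simp
  refine ⟨_, _, h1, h2, U, inferInstance, distU P K, q, r, ⟨hUnn, ?_⟩, hq, hr, fun x y => ?_,
    condEntropy_eq_sum hq hX, condEntropy_eq_sum hr hY⟩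
  · simp only [distU]
    rw [Finset.sum_comm]
    simp only [← Finset.mul_sum, (hK _).2, mul_one, hP.2]
  · calc P (x, y) = ∑ u, P (x, y) * K (x, y) u := by rw [← Finset.mul_sum, (hK _).2, mul_one]
      _ = _ := Finset.sum_congr rfl fun u _ => ?_
    by_cases h : distU P K u = 0
    · rw [h, zero_mul]
      rw [distU, Finset.sum_eq_zero_iff_of_nonneg fun z _ => hnn z u] at h
      exact h _ (Finset.mem_univ _)
    · have := hM x y u
      rw [hX, hY] at this
      apply mul_right_cancel₀ h
      rw [this]
      ring

lemma entropy_single {A : Type*} [Fintype A] [DecidableEq A] (a : A) :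
    entropy (Pi.single a (1 : ℝ)) = 0 := by
  rw [entropy, neg_eq_zero]
  refine Finset.sum_eq_zero fun b _ => ?_
  rcases eq_or_ne b a with rfl | h
  · simp
  · simp [h]

/-- Revealing `X` with probability `1 - t` scales `H(X|U)` by `t`, and leaves `H(Y|U)` as it is:
with probability `1 - t` the factor `q_u` is split into point masses. -/
lemma IsProductMixture.scale_left {X Y : Type*} [Fintype X] [Fintype Y] {P : X × Y → ℝ} {a b : ℝ}
    (h : IsProductMixture P a b) {t : ℝ} (h0 : 0 ≤ t) (h1 : t ≤ 1) :
    IsProductMixture P (t * a) b := by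
  classical
  obtain ⟨U, _, w, q, r, hw, hq, hr, hmix, rfl, rfl⟩ := h
  -- The alphabet `U × Option X` need not live in `Type`, so `X` is replaced by `Fin (card X)`.
  let e := (Fintype.equivFin X).symm
  have he : ∀ f : X → ℝ, ∑ i, f (e i) = ∑ x, f x := fun f => e.sum_comp f
  refine ⟨U × Option (Fin (Fintype.card X)), inferInstance,
    fun v => v.2.elim (w v.1 * t) fun i => w v.1 * (1 - t) * q v.1 (e i),
    fun v => v.2.elim (q v.1) fun i => Pi.single (e i) 1, fun v => r v.1, ⟨?_, ?_⟩, ?_,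
    fun v => hr _, fun x y => ?_, ?_, ?_⟩
  · rintro ⟨u, _ | i⟩
    · exact mul_nonneg (hw.1 u) h0
    · exact mul_nonneg (mul_nonneg (hw.1 u) (sub_nonneg.2 h1)) ((hq u).1 _)
  · simp only [Fintype.sum_prod_type, Fintype.sum_option, Option.elim_none, Option.elim_some,
      ← Finset.mul_sum]
    refine (Finset.sum_congr rfl fun u _ => ?_).trans hw.2
    rw [he (q u), (hq u).2]
    ring
  · rintro ⟨u, _ | i⟩
    · exact hq u
    · exact single_mem_stdSimplex ℝ _
  · rw [hmix]
    simp only [Fintype.sum_prod_type, Fintype.sum_option, Option.elim_none, Option.elim_some]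
    refine Finset.sum_congr rfl fun u _ => ?_
    have := he fun x' => w u * (1 - t) * q u x' * ((Pi.single x' 1 : X → ℝ) x * r u y)
    rw [this, Finset.sum_eq_single x (fun x' _ hx => by simp [hx.symm]) (by simp),
      Pi.single_eq_same]
    ring
  · simp only [Fintype.sum_prod_type, Fintype.sum_option, Option.elim_none, Option.elim_some,
      entropy_single, mul_zero, Finset.sum_const_zero, add_zero]
    rw [Finset.mul_sum]
    exact Finset.sum_congr rfl fun u _ => by ring
  · simp only [Fintype.sum_prod_type, Fintype.sum_option, Option.elim_none, Option.elim_some,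
      ← Finset.sum_mul, ← Finset.mul_sum]
    refine Finset.sum_congr rfl fun u _ => ?_
    rw [he (q u), (hq u).2]
    ring

lemma IsProductMixture.swap {X Y : Type*} [Fintype X] [Fintype Y] {P : X × Y → ℝ} {a b : ℝ}
    (h : IsProductMixture P a b) : IsProductMixture (fun z : Y × X => P z.swap) b a := by
  obtain ⟨U, _, w, q, r, hw, hq, hr, hmix, ha, hb⟩ := h
  refine ⟨U, inferInstance, w, r, q, hw, hr, hq, fun y x => ?_, hb, ha⟩
  simp only [Prod.swap_prod_mk, hmix, mul_comm]

lemma exists_mul_eq_of_nonneg_of_le {a b : ℝ} (h0 : 0 ≤ a) (h1 : a ≤ b) :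
    ∃ t, 0 ≤ t ∧ t ≤ 1 ∧ t * b = a := by
  rcases (h0.trans h1).eq_or_lt with h | h
  · exact ⟨0, le_rfl, zero_le_one, by linarith⟩
  · exact ⟨a / b, by positivity, (div_le_one h).2 h1, by field_simp⟩

/-- The pairs of mean entropies of product mixtures are closed under decreasing either entry. -/
lemma IsProductMixture.mono {X Y : Type*} [Fintype X] [Fintype Y] {P : X × Y → ℝ} {a b a' b' : ℝ}
    (h : IsProductMixture P a b) (ha' : 0 ≤ a') (ha : a' ≤ a) (hb' : 0 ≤ b') (hb : b' ≤ b) :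
    IsProductMixture P a' b' := by
  obtain ⟨s, hs0, hs1, rfl⟩ := exists_mul_eq_of_nonneg_of_le ha' ha
  obtain ⟨t, ht0, ht1, rfl⟩ := exists_mul_eq_of_nonneg_of_le hb' hb
  exact ((h.scale_left hs0 hs1).swap.scale_left ht0 ht1).swap

/-! ### Converse: splitting a set of sequences letter by letter -/

lemma letterCount_eq_sum {A : Type*} [DecidableEq A] {n : ℕ} (a : A) (x : Fin n → A) :
    (letterCount a x : ℝ) = ∑ i, if x i = a then (1 : ℝ) else 0 := by
  rw [letterCount, Set.ncard_eq_toFinset_card', Finset.sum_boole]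
  congr 2
  ext i
  simp

lemma letterCount_cons {A : Type*} [DecidableEq A] {n : ℕ} (a b : A) (x : Fin n → A) :
    (letterCount a (Fin.cons b x : Fin (n + 1) → A) : ℝ)
      = (if b = a then 1 else 0) + letterCount a x := by
  rw [letterCount_eq_sum, letterCount_eq_sum, Fin.sum_univ_succ]
  simp

/-- The tails of the members of `E` that begin with the letter `z`. -/
def tailsOf {A : Type*} [Fintype A] [DecidableEq A] {n : ℕ} (E : Finset (Fin (n + 1) → A)) (z : A) :
    Finset (Fin n → A) :=
  Finset.univ.filter fun t => (Fin.cons z t : Fin (n + 1) → A) ∈ E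

lemma mem_tailsOf {A : Type*} [Fintype A] [DecidableEq A] {n : ℕ} {E : Finset (Fin (n + 1) → A)}
    {z : A} {t : Fin n → A} : t ∈ tailsOf E z ↔ (Fin.cons z t : Fin (n + 1) → A) ∈ E := by
  simp [tailsOf]

lemma sum_eq_sum_tailsOf {A : Type*} [Fintype A] [DecidableEq A] {n : ℕ}
    (E : Finset (Fin (n + 1) → A)) (F : (Fin (n + 1) → A) → ℝ) :
    ∑ e ∈ E, F e = ∑ z, ∑ t ∈ tailsOf E z, F (Fin.cons z t) := by
  have h1 : ∑ e ∈ E, F e = ∑ e, if e ∈ E then F e else 0 := by simp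
  rw [h1, ← (Fin.consEquiv fun _ : Fin (n + 1) => A).sum_comp, Fintype.sum_prod_type]
  refine Finset.sum_congr rfl fun z _ => ?_
  rw [tailsOf, Finset.sum_filter]
  rfl

lemma card_eq_sum_card_tailsOf {A : Type*} [Fintype A] [DecidableEq A] {n : ℕ}
    (E : Finset (Fin (n + 1) → A)) : (E.card : ℝ) = ∑ z, ((tailsOf E z).card : ℝ) := by
  simpa using sum_eq_sum_tailsOf E fun _ => 1

/-- The distribution of the first letter of a uniformly chosen member of `E`. -/
noncomputable def firstLetterDist {A : Type*} [Fintype A] [DecidableEq A] {n : ℕ}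
    (E : Finset (Fin (n + 1) → A)) (z : A) : ℝ :=
  (tailsOf E z).card / E.card

lemma firstLetterDist_mem_stdSimplex {A : Type*} [Fintype A] [DecidableEq A] {n : ℕ}
    {E : Finset (Fin (n + 1) → A)} (hE : E.Nonempty) :
    firstLetterDist E ∈ stdSimplex ℝ A := by
  refine ⟨fun z => by unfold firstLetterDist; positivity, ?_⟩
  have : (E.card : ℝ) ≠ 0 := by exact_mod_cast hE.card_ne_zero
  simp only [firstLetterDist, ← Finset.sum_div]
  rw [← card_eq_sum_card_tailsOf, div_self this]

lemma tailsOf_nonempty_of_pos {A : Type*} [Fintype A] [DecidableEq A] {n : ℕ}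
    {E : Finset (Fin (n + 1) → A)} {z : A} (h : 0 < firstLetterDist E z) :
    (tailsOf E z).Nonempty := by
  by_contra h0
  rw [Finset.not_nonempty_iff_eq_empty] at h0
  simp [firstLetterDist, h0] at h

/-- The chain rule for the uniform distribution on `E`. -/
lemma entropy_firstLetterDist_add {A : Type*} [Fintype A] [DecidableEq A] {n : ℕ}
    {E : Finset (Fin (n + 1) → A)} (hE : E.Nonempty) :
    entropy (firstLetterDist E) + ∑ z, firstLetterDist E z * Real.logb 2 (tailsOf E z).card
      = Real.logb 2 E.card := by
  have hc : (E.card : ℝ) ≠ 0 := by exact_mod_cast hE.card_ne_zero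
  rw [entropy, ← Finset.sum_neg_distrib, ← Finset.sum_add_distrib, ← one_mul (Real.logb 2 E.card),
    ← (firstLetterDist_mem_stdSimplex hE).2, Finset.sum_mul]
  refine Finset.sum_congr rfl fun z _ => ?_
  rcases eq_or_ne ((tailsOf E z).card : ℝ) 0 with h | h
  · simp [firstLetterDist, h]
  · rw [firstLetterDist, Real.logb_div h hc]
    ring

/-- For a letterwise image of `E`, the chain rule is an inequality, because the tails of the image
that follow a letter include those of each of the preimages of that letter. -/
lemma entropy_pushforward_firstLetterDist_add_le {A B : Type*} [Fintype A] [DecidableEq A]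
    [Fintype B] [DecidableEq B] {n : ℕ} {E : Finset (Fin (n + 1) → A)} (hE : E.Nonempty)
    (π : A → B) :
    entropy (pushforward π (firstLetterDist E))
      + ∑ z, firstLetterDist E z * Real.logb 2 ((tailsOf E z).image (π ∘ ·)).card
      ≤ Real.logb 2 (E.image (π ∘ ·)).card := by
  have hp := firstLetterDist_mem_stdSimplex hE
  set p := firstLetterDist E
  set F := E.image (π ∘ ·)
  have hsub : ∀ z, (tailsOf E z).image (π ∘ ·) ⊆ tailsOf F (π z) := by
    intro z s hs
    obtain ⟨t, ht, rfl⟩ := Finset.mem_image.1 hs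
    rw [mem_tailsOf] at ht ⊢
    refine Finset.mem_image.2 ⟨_, ht, ?_⟩
    funext i
    refine Fin.cases ?_ (fun j => ?_) i <;> simp
  have hpos : ∀ z, 0 < p z → 0 < ((tailsOf E z).image (π ∘ ·)).card := fun z hz =>
    ((tailsOf_nonempty_of_pos hz).image _).card_pos
  have h1 : ∑ z, p z * Real.logb 2 ((tailsOf E z).image (π ∘ ·)).card
      ≤ ∑ z, p z * Real.logb 2 (tailsOf F (π z)).card := by
    refine Finset.sum_le_sum fun z _ => ?_
    rcases (hp.1 z).eq_or_lt with h | h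
    · simp [← h]
    · refine mul_le_mul_of_nonneg_left (Real.logb_le_logb_of_le one_lt_two ?_ ?_) h.le
      · exact_mod_cast hpos z h
      · exact_mod_cast Finset.card_le_card (hsub z)
  have h2 := entropy_add_sum_mul_logb_le (p := pushforward π p)
    (m := fun b => ((tailsOf F b).card : ℝ)) (pushforward_mem_stdSimplex π hp)
    (fun b => by positivity) fun b hb => by
      obtain ⟨z, -, hz⟩ := Finset.exists_ne_zero_of_sum_ne_zero hb.ne'
      split_ifs at hz with hzb
      · subst hzb
        exact_mod_cast (hpos z ((hp.1 z).lt_of_ne' hz)).trans_le (Finset.card_le_card (hsub z))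
      · exact absurd rfl hz
  rw [← card_eq_sum_card_tailsOf, sum_pushforward_mul] at h2
  linarith

/-- The graph of the map that sends a joint distribution `p` to the entropies of its two margins and
its own entropy. -/
def entropyGraph (X Y : Type*) [Fintype X] [Fintype Y] : Set ((X × Y → ℝ) × ℝ × ℝ × ℝ) :=
  (fun p => (p, entropy (margFst p), entropy (margSnd p), entropy p)) '' stdSimplex ℝ (X × Y)

lemma isCompact_convexHull_entropyGraph (X Y : Type*) [Fintype X] [Fintype Y] :
    IsCompact (convexHull ℝ (entropyGraph X Y)) := by
  refine isCompact_convexHull_of_finiteDimensional ((isCompact_stdSimplex ℝ _).image ?_)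
  have h1 : Continuous (margFst : (X × Y → ℝ) → X → ℝ) := by unfold margFst; fun_prop
  have h2 : Continuous (margSnd : (X × Y → ℝ) → Y → ℝ) := by unfold margSnd; fun_prop
  exact continuous_id.prodMk ((continuous_entropy.comp h1).prodMk
    ((continuous_entropy.comp h2).prodMk continuous_entropy))

open scoped Pointwise in
/-- Single-letterization. For a uniformly chosen member of a set `E` of `n` letter pairs, with `U_i`
the pairs before position `i`, the sums over `i` of the distribution of the `i`-th pair and of
`H(X_i|U_i)`, `H(Y_i|U_i)`, `H(X_i, Y_i|U_i)` form `n` times a convex combination of points of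
`entropyGraph`. The first two entropies are at most the logarithms of the sizes of the projections
of `E`, and the third is the logarithm of the size of `E`. -/
lemma exists_mem_smul_convexHull_entropyGraph {X Y : Type*} [Fintype X] [Fintype Y] [DecidableEq X]
    [DecidableEq Y] (n : ℕ) (E : Finset (Fin n → X × Y)) (hE : E.Nonempty)
    [Nonempty (X × Y)] :
    ∃ a b : ℝ, a ≤ Real.logb 2 (E.image (Prod.fst ∘ ·)).card ∧
      b ≤ Real.logb 2 (E.image (Prod.snd ∘ ·)).card ∧
      ((fun z => (∑ e ∈ E, (letterCount z e : ℝ)) / E.card, a, b, Real.logb 2 E.card) :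
        (X × Y → ℝ) × ℝ × ℝ × ℝ) ∈ (n : ℝ) • convexHull ℝ (entropyGraph X Y) := by
  induction n with
  | zero =>
    have hcard : E.card = 1 :=
      le_antisymm (Finset.card_le_one_of_subsingleton E) hE.card_pos
    have hne : (convexHull ℝ (entropyGraph X Y)).Nonempty := by
      rw [convexHull_nonempty_iff]
      exact Set.Nonempty.image _ ⟨_, single_mem_stdSimplex ℝ (Classical.arbitrary (X × Y))⟩
    refine ⟨0, 0, Real.logb_nonneg one_lt_two ?_, Real.logb_nonneg one_lt_two ?_, ?_⟩
    · exact_mod_cast (hE.image _).card_pos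
    · exact_mod_cast (hE.image _).card_pos
    · rw [Nat.cast_zero, Set.zero_smul_set hne, Set.mem_zero, hcard]
      ext <;> simp [letterCount_eq_sum]
  | succ n ih =>
    have hp := firstLetterDist_mem_stdSimplex hE
    set p := firstLetterDist E with hpdef
    set C := convexHull ℝ (entropyGraph X Y) with hC
    have hCc : Convex ℝ C := convex_convexHull ℝ _
    have hc : (E.card : ℝ) ≠ 0 := by exact_mod_cast hE.card_ne_zero
    -- The point for `E` is that of the first letter plus the average, over the first letter, of the
    -- points for the tails; a letter of probability zero gets an irrelevant point of the same set.
    have hchoice : ∀ z, ∃ v : (X × Y → ℝ) × ℝ × ℝ × ℝ, v ∈ (n : ℝ) • C ∧ (0 < p z →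
        v.2.1 ≤ Real.logb 2 ((tailsOf E z).image (Prod.fst ∘ ·)).card ∧
        v.2.2.1 ≤ Real.logb 2 ((tailsOf E z).image (Prod.snd ∘ ·)).card ∧
        v.1 = (fun z' => (∑ e ∈ tailsOf E z, (letterCount z' e : ℝ)) / (tailsOf E z).card) ∧
        v.2.2.2 = Real.logb 2 (tailsOf E z).card) := by
      intro z
      by_cases hz : 0 < p z
      · obtain ⟨a, b, ha, hb, h⟩ := ih (tailsOf E z) (tailsOf_nonempty_of_pos hz)
        exact ⟨_, h, fun _ => ⟨ha, hb, rfl, rfl⟩⟩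
      · obtain ⟨a, b, -, -, h⟩ := ih Finset.univ Finset.univ_nonempty
        exact ⟨_, h, fun h => absurd h hz⟩
    choose v hv hvp using hchoice
    have hsum : ∑ z, p z • v z ∈ (n : ℝ) • C :=
      (hCc.smul (n : ℝ)).sum_mem (fun z _ => hp.1 z) hp.2 fun z _ => hv z
    have hfirst : ((p, entropy (margFst p), entropy (margSnd p), entropy p) :
        (X × Y → ℝ) × ℝ × ℝ × ℝ) ∈ (1 : ℝ) • C := by
      rw [one_smul]
      exact subset_convexHull ℝ _ ⟨p, hp, rfl⟩
    have hmem := Set.add_mem_add hsum hfirst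
    rw [← hCc.add_smul (Nat.cast_nonneg n) zero_le_one] at hmem
    have hle : ∀ f g : X × Y → ℝ, (∀ z, 0 < p z → f z ≤ g z) →
        ∑ z, p z * f z ≤ ∑ z, p z * g z := by
      intro f g hfg
      refine Finset.sum_le_sum fun z _ => ?_
      rcases (hp.1 z).eq_or_lt with h | h
      · simp [← h]
      · exact mul_le_mul_of_nonneg_left (hfg z h) h.le
    refine ⟨∑ z, p z * (v z).2.1 + entropy (margFst p),
      ∑ z, p z * (v z).2.2.1 + entropy (margSnd p), ?_, ?_, ?_⟩
    · have h1 := entropy_pushforward_firstLetterDist_add_le hE Prod.fst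
      rw [pushforward_fst] at h1
      have h2 := hle _ _ fun z hz => (hvp z hz).1
      linarith
    · have h1 := entropy_pushforward_firstLetterDist_add_le hE Prod.snd
      rw [pushforward_snd] at h1
      have h2 := hle _ _ fun z hz => (hvp z hz).2.1
      linarith
    · push_cast
      convert hmem using 1
      refine Prod.ext ?_ (Prod.ext ?_ (Prod.ext ?_ ?_))
      · funext w
        simp only [Prod.fst_add, Prod.fst_sum, Prod.smul_fst, Pi.add_apply, Finset.sum_apply,
          Pi.smul_apply, smul_eq_mul]
        rw [sum_eq_sum_tailsOf, Finset.sum_div]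
        have hpw : p w = ∑ z, if z = w then p z else 0 := by simp
        rw [hpw, ← Finset.sum_add_distrib]
        refine Finset.sum_congr rfl fun z _ => ?_
        simp only [letterCount_cons, Finset.sum_add_distrib, Finset.sum_const, nsmul_eq_mul]
        rcases (hp.1 z).eq_or_lt with h | h
        · have h0 : tailsOf E z = ∅ := by
            have h' := h.symm
            rw [hpdef, firstLetterDist, div_eq_zero_iff, or_iff_left hc] at h'
            simpa using h'
          simp [h0, ← h]
        · rw [(hvp z h).2.2.1]
          have hz : ((tailsOf E z).card : ℝ) ≠ 0 := by
            exact_mod_cast (tailsOf_nonempty_of_pos h).card_ne_zero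
          simp only [hpdef, firstLetterDist]
          split_ifs <;> field_simp <;> ring
      · simp only [Prod.fst_add, Prod.snd_add, Prod.fst_sum, Prod.snd_sum, Prod.smul_fst,
          Prod.smul_snd, smul_eq_mul]
      · simp only [Prod.fst_add, Prod.snd_add, Prod.fst_sum, Prod.snd_sum, Prod.smul_fst,
          Prod.smul_snd, smul_eq_mul]
      · simp only [Prod.snd_add, Prod.snd_sum, Prod.smul_snd, smul_eq_mul]
        rw [← entropy_firstLetterDist_add hE, add_comm]
        congr 1
        refine Finset.sum_congr rfl fun z _ => ?_
        rcases (hp.1 z).eq_or_lt with h | h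
        · change p z * _ = p z * _
          rw [← h, zero_mul, zero_mul]
        · rw [(hvp z h).2.2.2]

/-! ### Converse: the edges of a nearly complete subgraph -/

lemma neighborSet_inl {X Y : Type*} [Fintype X] [Fintype Y] {P : X × Y → ℝ} {ε₁ ε₂ lam : ℝ} {n : ℕ}
    (Γ : (typicalityGraph P ε₁ ε₂ lam n).Subgraph) (x : typicalSet (margFst P) ε₁ n) :
    Γ.neighborSet (Sum.inl x) = Sum.inr '' {y | Γ.Adj (Sum.inl x) (Sum.inr y)} := by
  ext (y | y)
  · have : ¬Γ.Adj (Sum.inl x) (Sum.inl y) := fun h => Γ.adj_sub h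
    simpa using this
  · simp

lemma neighborSet_inr {X Y : Type*} [Fintype X] [Fintype Y] {P : X × Y → ℝ} {ε₁ ε₂ lam : ℝ} {n : ℕ}
    (Γ : (typicalityGraph P ε₁ ε₂ lam n).Subgraph) (y : typicalSet (margSnd P) ε₂ n) :
    Γ.neighborSet (Sum.inr y) = Sum.inl '' {x | Γ.Adj (Sum.inr y) (Sum.inl x)} := by
  ext (x | x)
  · simp
  · have : ¬Γ.Adj (Sum.inr y) (Sum.inr x) := fun h => Γ.adj_sub h
    simpa using this

open Classical in
/-- The edges of a subgraph of the typicality graph, as sequences of pairs of letters. -/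
noncomputable def edgeSeqs {X Y : Type*} [Fintype X] [Fintype Y] {P : X × Y → ℝ} {ε₁ ε₂ lam : ℝ}
    {n : ℕ} (Γ : (typicalityGraph P ε₁ ε₂ lam n).Subgraph) : Finset (Fin n → X × Y) :=
  Finset.univ.filter fun e => ∃ x y, Γ.Adj (Sum.inl x) (Sum.inr y) ∧ (fun i => (x.1 i, y.1 i)) = e

lemma mem_edgeSeqs {X Y : Type*} [Fintype X] [Fintype Y] {P : X × Y → ℝ} {ε₁ ε₂ lam : ℝ}
    {n : ℕ} {Γ : (typicalityGraph P ε₁ ε₂ lam n).Subgraph} {e : Fin n → X × Y} : e ∈ edgeSeqs Γ ↔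
      ∃ x y, Γ.Adj (Sum.inl x) (Sum.inr y) ∧ (fun i => (x.1 i, y.1 i)) = e := by
  simp [edgeSeqs]

lemma mem_typicalSet_of_mem_edgeSeqs {X Y : Type*} [Fintype X] [Fintype Y] {P : X × Y → ℝ}
    {ε₁ ε₂ lam : ℝ} {n : ℕ} {Γ : (typicalityGraph P ε₁ ε₂ lam n).Subgraph} {e : Fin n → X × Y}
    (he : e ∈ edgeSeqs Γ) : e ∈ typicalSet P lam n := by
  obtain ⟨x, y, hxy, rfl⟩ := mem_edgeSeqs.1 he
  exact Γ.adj_sub hxy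

lemma card_image_fst_edgeSeqs_le {X Y : Type*} [Fintype X] [Fintype Y] [DecidableEq X]
    {P : X × Y → ℝ} {ε₁ ε₂ lam : ℝ} {n : ℕ} (Γ : (typicalityGraph P ε₁ ε₂ lam n).Subgraph) :
    ((edgeSeqs Γ).image (Prod.fst ∘ ·)).card ≤ (leftVerts Γ).ncard := by
  rw [← Set.ncard_coe_finset, ← Set.ncard_image_of_injective _ Subtype.val_injective]
  refine Set.ncard_le_ncard ?_ (Set.toFinite _)
  intro s hs
  obtain ⟨e, he, rfl⟩ := Finset.mem_image.1 (Finset.mem_coe.1 hs)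
  obtain ⟨x, y, hxy, rfl⟩ := mem_edgeSeqs.1 he
  exact ⟨x, Γ.edge_vert hxy, rfl⟩

lemma card_image_snd_edgeSeqs_le {X Y : Type*} [Fintype X] [Fintype Y] [DecidableEq Y]
    {P : X × Y → ℝ} {ε₁ ε₂ lam : ℝ} {n : ℕ} (Γ : (typicalityGraph P ε₁ ε₂ lam n).Subgraph) :
    ((edgeSeqs Γ).image (Prod.snd ∘ ·)).card ≤ (rightVerts Γ).ncard := by
  rw [← Set.ncard_coe_finset, ← Set.ncard_image_of_injective _ Subtype.val_injective]
  refine Set.ncard_le_ncard ?_ (Set.toFinite _)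
  intro s hs
  obtain ⟨e, he, rfl⟩ := Finset.mem_image.1 (Finset.mem_coe.1 hs)
  obtain ⟨x, y, hxy, rfl⟩ := mem_edgeSeqs.1 he
  exact ⟨y, Γ.edge_vert hxy.symm, rfl⟩

lemma ncard_leftVerts_mul_le_card_edgeSeqs {X Y : Type*} [Fintype X] [Fintype Y] {P : X × Y → ℝ}
    {ε₁ ε₂ lam : ℝ} {n : ℕ} (Γ : (typicalityGraph P ε₁ ε₂ lam n).Subgraph) {d : ℝ}
    (hd : ∀ x ∈ leftVerts Γ, d ≤ subDegree Γ (Sum.inl x)) :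
    (leftVerts Γ).ncard * d ≤ (edgeSeqs Γ).card := by
  classical
  set L : Finset (Fin n → X) := (Set.toFinite (Subtype.val '' leftVerts Γ)).toFinset with hL
  have hLcard : (leftVerts Γ).ncard = L.card := by
    rw [← Set.ncard_image_of_injective _ Subtype.val_injective, hL, Set.ncard_eq_toFinset_card]
  have hmaps : ∀ e ∈ edgeSeqs Γ, (Prod.fst ∘ e) ∈ L := by
    intro e he
    obtain ⟨x, y, hxy, rfl⟩ := mem_edgeSeqs.1 he
    rw [hL, Set.Finite.mem_toFinset]
    exact ⟨x, Γ.edge_vert hxy, rfl⟩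
  rw [Finset.card_eq_sum_card_fiberwise hmaps, hLcard, Nat.cast_sum, ← nsmul_eq_mul]
  refine Finset.card_nsmul_le_sum _ _ _ fun s hs => ?_
  rw [hL, Set.Finite.mem_toFinset] at hs
  obtain ⟨x, hx, rfl⟩ := hs
  refine (hd x hx).trans ?_
  have hinj : Function.Injective
      fun (y : typicalSet (margSnd P) ε₂ n) (i : Fin n) => (x.1 i, y.1 i) := fun y y' h =>
    Subtype.ext (funext fun i => congrArg Prod.snd (congrFun h i))
  rw [subDegree, neighborSet_inl, Set.ncard_image_of_injective _ Sum.inr_injective,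
    ← Set.ncard_image_of_injective _ hinj, ← Set.ncard_coe_finset]
  refine Nat.cast_le.2 (Set.ncard_le_ncard ?_ (Set.toFinite _))
  rintro _ ⟨y, hy, rfl⟩
  rw [Finset.mem_coe, Finset.mem_filter]
  exact ⟨mem_edgeSeqs.2 ⟨x, y, hy, rfl⟩, rfl⟩

/-- At one block length, the edges of a nearly complete subgraph give a point of the convex hull of
`entropyGraph` that is close to `(P, RX, RY, RX + RY)`, on the side that matters. -/
lemma IsNearlyComplete.exists_mem_convexHull {X Y : Type*} [Fintype X] [Fintype Y] {P : X × Y → ℝ}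
    {ε₁ ε₂ lam RX RY δ : ℝ} {n : ℕ} (hn : 0 < n) {Γ : (typicalityGraph P ε₁ ε₂ lam n).Subgraph}
    (hΓ : IsNearlyComplete Γ n RX RY δ) :
    ∃ v ∈ convexHull ℝ (entropyGraph X Y), (∀ z, |v.1 z - P z| ≤ lam) ∧ v.2.1 ≤ RX + δ ∧
      v.2.2.1 ≤ RY + δ ∧ RX + RY - 2 * δ ≤ v.2.2.2 := by
  classical
  have hn' : (0 : ℝ) < n := by exact_mod_cast hn
  obtain ⟨⟨hL, hLR⟩, ⟨hR, hRR⟩, hdeg, -⟩ := hΓ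
  rw [abs_le] at hLR hRR
  have hL' : (0 : ℝ) < (leftVerts Γ).ncard := by exact_mod_cast hL
  have hE : (leftVerts Γ).ncard * (2 : ℝ) ^ (n * (RY - δ)) ≤ (edgeSeqs Γ).card :=
    ncard_leftVerts_mul_le_card_edgeSeqs Γ fun x hx => by
      obtain ⟨h0, h1⟩ := hdeg x hx
      rw [← Real.le_logb_iff_rpow_le one_lt_two (by exact_mod_cast h0), mul_comm]
      rwa [le_div_iff₀ hn'] at h1
  have hpow : (0 : ℝ) < (2 : ℝ) ^ (n * (RY - δ)) := Real.rpow_pos_of_pos two_pos _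
  have hEpos : (0 : ℝ) < (edgeSeqs Γ).card := (mul_pos hL' hpow).trans_le hE
  have hEne : (edgeSeqs Γ).Nonempty := Finset.card_pos.1 (by exact_mod_cast hEpos)
  have hElog : n * (RX + RY - 2 * δ) ≤ Real.logb 2 (edgeSeqs Γ).card := by
    have h1 := Real.logb_le_logb_of_le one_lt_two (mul_pos hL' hpow) hE
    rw [Real.logb_mul hL'.ne' hpow.ne', Real.logb_rpow two_pos (by norm_num)] at h1
    have h2 := hLR.1
    rw [neg_le_sub_iff_le_add, ← sub_le_iff_le_add, le_div_iff₀ hn'] at h2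
    linarith
  obtain ⟨e₀, he₀⟩ := hEne
  have : Nonempty (X × Y) := ⟨e₀ ⟨0, hn⟩⟩
  obtain ⟨a, b, ha, hb, v, hv, hve⟩ :=
    exists_mem_smul_convexHull_entropyGraph n (edgeSeqs Γ) ⟨e₀, he₀⟩
  simp only [Prod.ext_iff] at hve
  obtain ⟨hv1, hv2, hv3, hv4⟩ := hve
  simp only [Prod.smul_fst, Prod.smul_snd, smul_eq_mul] at hv1 hv2 hv3 hv4
  have hlogle : ∀ {k m : ℕ}, 0 < k → k ≤ m → Real.logb 2 k ≤ Real.logb 2 m := fun hk hkm =>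
    Real.logb_le_logb_of_le one_lt_two (by exact_mod_cast hk) (by exact_mod_cast hkm)
  refine ⟨v, hv, fun z => ?_, ?_, ?_, ?_⟩
  · have h1 : v.1 z = (∑ e ∈ edgeSeqs Γ, ((letterCount z e : ℝ) / n)) / (edgeSeqs Γ).card := by
      have := congrFun hv1 z
      simp only [Pi.smul_apply, smul_eq_mul] at this
      rw [← Finset.sum_div, div_right_comm, ← this]
      field_simp
    have h2 : v.1 z - P z
        = (∑ e ∈ edgeSeqs Γ, ((letterCount z e : ℝ) / n - P z)) / (edgeSeqs Γ).card := by
      rw [h1, Finset.sum_sub_distrib, Finset.sum_const, nsmul_eq_mul, sub_div,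
        mul_div_cancel_left₀ _ hEpos.ne']
    rw [h2, abs_div, Nat.abs_cast, div_le_iff₀ hEpos]
    calc _ ≤ ∑ e ∈ edgeSeqs Γ, |(letterCount z e : ℝ) / n - P z| := Finset.abs_sum_le_sum_abs _ _
      _ ≤ ∑ e ∈ edgeSeqs Γ, lam := Finset.sum_le_sum fun e he =>
          (mem_typicalSet_of_mem_edgeSeqs he).1 z
      _ = lam * (edgeSeqs Γ).card := by rw [Finset.sum_const, nsmul_eq_mul, mul_comm]
  · have h1 := hlogle ((Finset.Nonempty.image ⟨e₀, he₀⟩ _).card_pos) (card_image_fst_edgeSeqs_le Γ)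
    have h2 := hLR.2
    rw [sub_le_iff_le_add, div_le_iff₀ hn'] at h2
    exact le_of_mul_le_mul_left (by linarith) hn'
  · have h1 := hlogle ((Finset.Nonempty.image ⟨e₀, he₀⟩ _).card_pos) (card_image_snd_edgeSeqs_le Γ)
    have h2 := hRR.2
    rw [sub_le_iff_le_add, div_le_iff₀ hn'] at h2
    exact le_of_mul_le_mul_left (by linarith) hn'
  · exact le_of_mul_le_mul_left (by linarith) hn'

/-- A convex combination of points of `entropyGraph` in which the joint entropy is not smaller than
the sum of the entropies of the margins is a mixture of product distributions. -/
lemma isProductMixture_of_mem_convexHull {X Y : Type*} [Fintype X] [Fintype Y] {P : X × Y → ℝ}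
    {a b c RX RY : ℝ} (h : (P, a, b, c) ∈ convexHull ℝ (entropyGraph X Y)) (ha : a ≤ RX)
    (hb : b ≤ RY) (hc : RX + RY ≤ c) : IsProductMixture P RX RY := by
  have hV := mem_convexHull_iff_exists_fintype.1 h
  obtain ⟨U, _, w, v, hw0, hw1, hv, hsum⟩ := hV
  choose p hp hpv using hv
  simp only [← hpv, Prod.ext_iff, Prod.fst_sum, Prod.snd_sum, Prod.smul_fst, Prod.smul_snd,
    smul_eq_mul] at hsum
  obtain ⟨h1, h2, h3, h4⟩ := hsum
  have hle : ∀ u ∈ Finset.univ, w u * entropy (p u) ≤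
      w u * (entropy (margFst (p u)) + entropy (margSnd (p u))) := fun u _ =>
    mul_le_mul_of_nonneg_left (entropy_le_add_margins (hp u)) (hw0 u)
  have hsumle := Finset.sum_le_sum hle
  have hsplit : ∑ u, w u * (entropy (margFst (p u)) + entropy (margSnd (p u))) = a + b := by
    simp only [mul_add, Finset.sum_add_distrib, h2, h3]
  have heq := (Finset.sum_eq_sum_iff_of_le hle).1 (by linarith)
  refine ⟨U, inferInstance, w, fun u => margFst (p u), fun u => margSnd (p u), ⟨hw0, hw1⟩,
    fun u => margFst_mem_stdSimplex (hp u), fun u => margSnd_mem_stdSimplex (hp u), fun x y => ?_,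
    by linarith, by linarith⟩
  rw [← h1, Finset.sum_apply]
  refine Finset.sum_congr rfl fun u _ => ?_
  rw [Pi.smul_apply, smul_eq_mul]
  rcases eq_or_ne (w u) 0 with h0 | h0
  · rw [h0, zero_mul, zero_mul]
  · rw [eq_mul_margins_of_entropy_eq (hp u)
      (mul_left_cancel₀ h0 (heq u (Finset.mem_univ u))) (x, y)]

/-- The rates of nearly complete subgraphs are the mean entropies of a product mixture, obtained as a
limit of the single-letterizations of the edge sets. -/
lemma IsNearlyCompleteSeq.isProductMixture {X Y : Type*} [Fintype X] [Fintype Y] {P : X × Y → ℝ}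
    {ε₁ ε₂ lam δ : ℕ → ℝ} {RX RY : ℝ}
    {Γ : ∀ n, (typicalityGraph P (ε₁ n) (ε₂ n) (lam n) n).Subgraph}
    (hlam : Tendsto lam atTop (𝓝 0)) (h : IsNearlyCompleteSeq P ε₁ ε₂ lam Γ RX RY δ) :
    IsProductMixture P RX RY := by
  obtain ⟨hδ, hΓ⟩ := h
  have hev : ∀ᶠ n in atTop, ∃ v, v ∈ convexHull ℝ (entropyGraph X Y) ∧
      (∀ z, |v.1 z - P z| ≤ lam n) ∧ v.2.1 ≤ RX + δ n ∧ v.2.2.1 ≤ RY + δ n ∧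
      RX + RY - 2 * δ n ≤ v.2.2.2 := by
    filter_upwards [hΓ, eventually_gt_atTop 0] with n h1 h2
    exact h1.exists_mem_convexHull h2
  obtain ⟨v, hv⟩ := hev.choice
  obtain ⟨⟨P', a, b, c⟩, hmem, φ, hφ, hlim⟩ :=
    (isCompact_convexHull_entropyGraph X Y).tendsto_subseq' (hv.mono fun n h => h.1).frequently
  have hφt := hφ.tendsto_atTop
  have hvφ := hφt.eventually hv
  have hδφ := hδ.comp hφt
  have h1 : Tendsto (fun n => (v (φ n)).1) atTop (𝓝 P') := hlim.fst_nhds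
  have h2 : Tendsto (fun n => (v (φ n)).2.1) atTop (𝓝 a) := hlim.snd_nhds.fst_nhds
  have h3 : Tendsto (fun n => (v (φ n)).2.2.1) atTop (𝓝 b) := hlim.snd_nhds.snd_nhds.fst_nhds
  have h4 : Tendsto (fun n => (v (φ n)).2.2.2) atTop (𝓝 c) := hlim.snd_nhds.snd_nhds.snd_nhds
  have hPP : P' = P := by
    refine tendsto_nhds_unique h1 (tendsto_pi_nhds.2 fun z => ?_)
    rw [tendsto_iff_dist_tendsto_zero]
    refine squeeze_zero' (Eventually.of_forall fun _ => dist_nonneg) ?_ (hlam.comp hφt)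
    exact hvφ.mono fun n h => h.2.1 z
  subst hPP
  refine isProductMixture_of_mem_convexHull hmem ?_ ?_ ?_
  · refine le_of_tendsto_of_tendsto h2 (by simpa using hδφ.const_add RX) ?_
    exact hvφ.mono fun n h => h.2.2.1
  · refine le_of_tendsto_of_tendsto h3 (by simpa using hδφ.const_add RY) ?_
    exact hvφ.mono fun n h => h.2.2.2.1
  · refine le_of_tendsto_of_tendsto (by simpa using (hδφ.const_mul 2).const_sub (RX + RY)) h4 ?_
    exact hvφ.mono fun n h => h.2.2.2.2

lemma nonneg_of_eventually_hasLogRate {c : ℕ → ℕ} {R : ℝ} {δ : ℕ → ℝ} (hδ : Tendsto δ atTop (𝓝 0))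
    (h : ∀ᶠ n in atTop, HasLogRate (c n) n R (δ n)) : 0 ≤ R := by
  refine ge_of_tendsto (by simpa using hδ.const_add R) (h.mono fun n hn => ?_)
  have h0 : 0 ≤ Real.logb 2 (c n) / n :=
    div_nonneg (Real.logb_nonneg one_lt_two (by exact_mod_cast hn.1)) (Nat.cast_nonneg n)
  have := (abs_le.1 hn.2).2
  linarith

lemma IsNearlyCompleteSeq.mem_markovRegion {X Y : Type*} [Fintype X] [Fintype Y] {P : X × Y → ℝ}
    (hP : P ∈ stdSimplex ℝ (X × Y)) {ε₁ ε₂ lam δ : ℕ → ℝ} {RX RY : ℝ}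
    {Γ : ∀ n, (typicalityGraph P (ε₁ n) (ε₂ n) (lam n) n).Subgraph}
    (hlam : Tendsto lam atTop (𝓝 0)) (h : IsNearlyCompleteSeq P ε₁ ε₂ lam Γ RX RY δ) :
    (RX, RY) ∈ markovRegion P :=
  (h.isProductMixture hlam).mem_markovRegion hP
    (nonneg_of_eventually_hasLogRate h.1 (h.2.mono fun _ hn => hn.left_size))
    (nonneg_of_eventually_hasLogRate h.1 (h.2.mono fun _ hn => hn.right_size))

/-! ### Achievability: Chebyshev's inequality for independent letters -/

lemma sum_pi_succ {A : Type*} [Fintype A] {n : ℕ} (F : (Fin (n + 1) → A) → ℝ) :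
    ∑ ω, F ω = ∑ a, ∑ t : Fin n → A, F (Fin.cons a t) := by
  rw [← (Fin.consEquiv fun _ : Fin (n + 1) => A).sum_comp, Fintype.sum_prod_type]
  rfl

lemma sum_prod_eq_one {A : Type*} [Fintype A] {n : ℕ} {Q : Fin n → A → ℝ}
    (hQ : ∀ i, ∑ a, Q i a = 1) : ∑ ω : Fin n → A, ∏ i, Q i (ω i) = 1 := by
  classical
  have h := Finset.prod_univ_sum (fun _ : Fin n => (Finset.univ : Finset A)) Q
  rw [Fintype.piFinset_univ] at h
  rw [← h]
  exact Finset.prod_eq_one fun i _ => hQ i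

lemma prod_mem_stdSimplex_pi {A : Type*} [Fintype A] {n : ℕ} {Q : Fin n → A → ℝ}
    (hQ : ∀ i, Q i ∈ stdSimplex ℝ A) :
    (fun ω : Fin n → A => ∏ i, Q i (ω i)) ∈ stdSimplex ℝ (Fin n → A) :=
  ⟨fun _ => Finset.prod_nonneg fun i _ => (hQ i).1 _, sum_prod_eq_one fun i => (hQ i).2⟩

/-- The variance of a sum of independent identically distributed centred variables. -/
lemma sum_prod_mul_sq_sum {A : Type*} [Fintype A] {Q f : A → ℝ} (hQ : ∑ a, Q a = 1)
    (hf : ∑ a, Q a * f a = 0) (n : ℕ) :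
    ∑ ω : Fin n → A, (∏ i, Q (ω i)) * (∑ i, f (ω i)) ^ 2 = n * ∑ a, Q a * f a ^ 2 := by
  induction n with
  | zero => simp
  | succ n ih =>
    have hW := sum_prod_eq_one (n := n) fun _ => hQ
    set W : (Fin n → A) → ℝ := fun t => ∏ i, Q (t i)
    set S : (Fin n → A) → ℝ := fun t => ∑ i, f (t i)
    calc _ = ∑ a, ∑ t, (Q a * f a ^ 2 * W t + 2 * (Q a * f a) * (W t * S t)
            + Q a * (W t * S t ^ 2)) := by
          rw [sum_pi_succ]
          refine Finset.sum_congr rfl fun a _ => Finset.sum_congr rfl fun t _ => ?_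
          simp only [Fin.prod_univ_succ, Fin.sum_univ_succ, Fin.cons_zero, Fin.cons_succ]
          change Q a * W t * (f a + S t) ^ 2 = _
          ring
      _ = (∑ a, Q a * f a ^ 2) * ∑ t, W t + 2 * (∑ a, Q a * f a) * ∑ t, W t * S t
            + (∑ a, Q a) * ∑ t, W t * S t ^ 2 := by
          simp only [Finset.sum_add_distrib, ← Finset.mul_sum, ← Finset.sum_mul]
      _ = _ := by
          rw [hW, hf, hQ, ih]
          push_cast
          ring

open Classical in
/-- **Chebyshev's inequality** for a sum of independent identically distributed variables. -/
lemma sum_prod_deviation_le {A : Type*} [Fintype A] {Q : A → ℝ} (hQ : Q ∈ stdSimplex ℝ A)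
    (f : A → ℝ) {m t : ℝ} (hm : ∑ a, Q a * f a = m) {n : ℕ} (hn : 0 < n) (ht : 0 < t) :
    ∑ ω : Fin n → A, (if n * t < |∑ i, f (ω i) - n * m| then ∏ i, Q (ω i) else 0)
      ≤ (∑ a, Q a * (f a - m) ^ 2) / (n * t ^ 2) := by
  have hn' : (0 : ℝ) < n := by exact_mod_cast hn
  have hcent : ∑ a, Q a * (f a - m) = 0 := by
    simp only [mul_sub, Finset.sum_sub_distrib, hm, ← Finset.sum_mul, hQ.2, one_mul, sub_self]
  have hvar := sum_prod_mul_sq_sum hQ.2 hcent n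
  have hrhs : (∑ a, Q a * (f a - m) ^ 2) / (n * t ^ 2)
      = (∑ ω : Fin n → A, (∏ i, Q (ω i)) * (∑ i, (f (ω i) - m)) ^ 2) / (n * t) ^ 2 := by
    rw [hvar]
    field_simp
  rw [hrhs, Finset.sum_div]
  refine Finset.sum_le_sum fun ω _ => ?_
  have hW : 0 ≤ ∏ i, Q (ω i) := Finset.prod_nonneg fun i _ => hQ.1 _
  split_ifs with h
  · have hsum : ∑ i, (f (ω i) - m) = ∑ i, f (ω i) - n * m := by
      simp [Finset.sum_sub_distrib]
    rw [hsum, le_div_iff₀ (by positivity)]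
    refine mul_le_mul_of_nonneg_left ?_ hW
    rw [← sq_abs (_ - _)]
    exact pow_le_pow_left₀ (by positivity) h.le 2
  · positivity

lemma DeltaConvention.tendsto_div {ε : ℕ → ℝ} (h : DeltaConvention ε) (V : ℝ) :
    Tendsto (fun n : ℕ => V / (n * ε n ^ 2)) atTop (𝓝 0) := by
  have h1 : Tendsto (fun n : ℕ => (n : ℝ) * ε n ^ 2) atTop atTop := by
    have := h.2.atTop_mul_atTop₀ h.2
    refine this.congr fun n => ?_
    rw [mul_mul_mul_comm, Real.mul_self_sqrt (Nat.cast_nonneg n), sq]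
  exact h1.const_div_atTop V

lemma DeltaConvention.eventually_pos {ε : ℕ → ℝ} (h : DeltaConvention ε) :
    ∀ᶠ n in atTop, 0 < ε n :=
  (h.2.eventually_gt_atTop 0).mono fun _ hn => pos_of_mul_pos_right hn (Real.sqrt_nonneg _)

open Classical in
/-- Finitely many empirical averages are simultaneously close to their means with high
probability. -/
lemma eventually_sum_prod_exists_deviation_le {A J : Type*} [Fintype A] [Fintype J] {Q : A → ℝ}
    (hQ : Q ∈ stdSimplex ℝ A) (f : J → A → ℝ) {m : J → ℝ} (hm : ∀ j, ∑ a, Q a * f j a = m j)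
    {t : J → ℕ → ℝ} (ht : ∀ j, DeltaConvention (t j)) {η : ℝ} (hη : 0 < η) :
    ∀ᶠ n : ℕ in atTop, ∑ ω : Fin n → A,
      (if ∃ j, n * t j n < |∑ i, f j (ω i) - n * m j| then ∏ i, Q (ω i) else 0) ≤ η := by
  have hlim : Tendsto (fun n : ℕ => ∑ j, (∑ a, Q a * (f j a - m j) ^ 2) / (n * t j n ^ 2)) atTop
      (𝓝 0) := by
    simpa using tendsto_finsetSum Finset.univ fun j _ => (ht j).tendsto_div _
  filter_upwards [hlim.eventually_le_const hη, eventually_gt_atTop 0,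
    eventually_all.2 fun j => (ht j).eventually_pos] with n h1 hn hpos
  refine le_trans ?_ h1
  calc _ ≤ ∑ ω : Fin n → A, ∑ j,
        (if n * t j n < |∑ i, f j (ω i) - n * m j| then ∏ i, Q (ω i) else 0) := by
        refine Finset.sum_le_sum fun ω _ => ?_
        have hnn : ∀ j ∈ Finset.univ, 0 ≤
            (if n * t j n < |∑ i, f j (ω i) - n * m j| then ∏ i, Q (ω i) else 0) := fun j _ => by
          split_ifs
          exacts [Finset.prod_nonneg fun i _ => hQ.1 _, le_rfl]
        split_ifs with h
        · obtain ⟨j, hj⟩ := h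
          refine le_trans ?_ (Finset.single_le_sum hnn (Finset.mem_univ j))
          rw [if_pos hj]
        · exact Finset.sum_nonneg hnn
    _ ≤ _ := by
        rw [Finset.sum_comm]
        exact Finset.sum_le_sum fun j _ => sum_prod_deviation_le hQ (f j) (hm j) hn (hpos j)

/-! ### Achievability: pruning a dense bipartite relation -/

open Classical in
/-- By Markov's inequality, the `x` with few bad partners have most of the mass. -/
lemma three_quarters_le_sum_filter {S T : Type*} [Fintype S] [Fintype T] {a : S → ℝ} {b : T → ℝ}
    (ha : a ∈ stdSimplex ℝ S) (hb : b ∈ stdSimplex ℝ T) (bad : S → T → Prop)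
    (h : ∑ x, ∑ y, (if bad x y then a x * b y else 0) ≤ 1 / 16) :
    3 / 4 ≤ ∑ x with 0 < a x ∧ ∑ y, (if bad x y then b y else 0) ≤ 1 / 4, a x := by
  have h1 : ∑ x with ¬(0 < a x ∧ ∑ y, (if bad x y then b y else 0) ≤ 1 / 4), a x
      ≤ ∑ x, 4 * ∑ y, (if bad x y then a x * b y else 0) := by
    have hnn : ∀ x, 0 ≤ ∑ y, (if bad x y then b y else 0) := fun x =>
      Finset.sum_nonneg fun y _ => by
        split_ifs
        exacts [hb.1 y, le_rfl]
    have heq : ∀ x, ∑ y, (if bad x y then a x * b y else 0)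
        = a x * ∑ y, (if bad x y then b y else 0) := fun x => by
      simp only [Finset.mul_sum, mul_ite, mul_zero]
    rw [Finset.sum_filter]
    refine Finset.sum_le_sum fun x _ => ?_
    rw [heq]
    have hx := ha.1 x
    have hx' := hnn x
    split_ifs with hc
    · positivity
    · rw [not_and, not_le] at hc
      rcases hx.eq_or_lt with h0 | h0
      · simp [← h0]
      · nlinarith [hc h0]
  rw [← Finset.mul_sum] at h1
  have h2 := Finset.sum_filter_add_sum_filter_not Finset.univ
    (fun x => 0 < a x ∧ ∑ y, (if bad x y then b y else 0) ≤ 1 / 4) a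
  rw [ha.2] at h2
  linarith

open Classical in
lemma half_le_sum_filter_not {T : Type*} [Fintype T] {b : T → ℝ}
    (hb : b ∈ stdSimplex ℝ T) (B : Finset T) (bad : T → Prop) (hB : 3 / 4 ≤ ∑ y ∈ B, b y)
    (h : ∑ y, (if bad y then b y else 0) ≤ 1 / 4) : 1 / 2 ≤ ∑ y ∈ B with ¬bad y, b y := by
  have h1 := Finset.sum_filter_add_sum_filter_not B bad b
  have h2 : ∑ y ∈ B with bad y, b y ≤ ∑ y, (if bad y then b y else 0) := by
    rw [← Finset.sum_filter]
    exact Finset.sum_le_sum_of_subset_of_nonneg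
      (Finset.filter_subset_filter _ (Finset.subset_univ B)) fun y _ _ => hb.1 y
  linarith

open Classical in
/-- If all but a sixteenth of the mass of a product distribution consists of good pairs, then there
are sets `A` and `B` in which the good partners of each element have at least half of the mass. -/
lemma exists_finset_good_pairs {S T : Type*} [Fintype S] [Fintype T] {a : S → ℝ} {b : T → ℝ}
    (ha : a ∈ stdSimplex ℝ S) (hb : b ∈ stdSimplex ℝ T) (bad : S → T → Prop)
    (h : ∑ x, ∑ y, (if bad x y then a x * b y else 0) ≤ 1 / 16) :
    ∃ (A : Finset S) (B : Finset T), (∀ x ∈ A, 0 < a x) ∧ (∀ y ∈ B, 0 < b y) ∧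
      1 / 2 ≤ ∑ x ∈ A, a x ∧ 1 / 2 ≤ ∑ y ∈ B, b y ∧
      (∀ x ∈ A, 1 / 2 ≤ ∑ y ∈ B with ¬bad x y, b y) ∧
      ∀ y ∈ B, 1 / 2 ≤ ∑ x ∈ A with ¬bad x y, a x := by
  have h' : ∑ y, ∑ x, (if bad x y then b y * a x else 0) ≤ 1 / 16 := by
    rw [Finset.sum_comm]
    simpa only [mul_comm] using h
  have hA := three_quarters_le_sum_filter ha hb bad h
  have hB := three_quarters_le_sum_filter hb ha (fun y x => bad x y) h'
  refine ⟨Finset.univ.filter fun x => 0 < a x ∧ ∑ y, (if bad x y then b y else 0) ≤ 1 / 4,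
    Finset.univ.filter fun y => 0 < b y ∧ ∑ x, (if bad x y then a x else 0) ≤ 1 / 4,
    fun x hx => (Finset.mem_filter.1 hx).2.1, fun y hy => (Finset.mem_filter.1 hy).2.1,
    by linarith, by linarith, fun x hx => ?_, fun y hy => ?_⟩
  · exact half_le_sum_filter_not hb _ _ hB (Finset.mem_filter.1 hx).2.2
  · exact half_le_sum_filter_not ha _ _ hA (Finset.mem_filter.1 hy).2.2

lemma sum_fun_triple {U X Y : Type*} [Fintype U] [Fintype X] [Fintype Y] {n : ℕ}
    (F : (Fin n → U × X × Y) → ℝ) :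
    ∑ ω, F ω = ∑ u : Fin n → U, ∑ x : Fin n → X, ∑ y : Fin n → Y, F fun i => (u i, x i, y i) := by
  rw [← (Equiv.arrowProdEquivProdArrow (Fin n) (fun _ => U) fun _ => X × Y).symm.sum_comp,
    Fintype.sum_prod_type]
  refine Finset.sum_congr rfl fun u _ => ?_
  rw [← (Equiv.arrowProdEquivProdArrow (Fin n) (fun _ => X) fun _ => Y).symm.sum_comp,
    Fintype.sum_prod_type]
  rfl

open Classical in
/-- Averaging over `u`: if bad triples are rare, then they are rare given some `u` of positive
weight. -/
lemma exists_fiber_sum_le {U X Y : Type*} [Fintype U] [Fintype X] [Fintype Y] {n : ℕ}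
    {w : U → ℝ} {q : U → X → ℝ} {r : U → Y → ℝ} (hw : w ∈ stdSimplex ℝ U)
    (bad : (Fin n → U × X × Y) → Prop) {η : ℝ}
    (h : ∑ ω : Fin n → U × X × Y,
      (if bad ω then ∏ i, w (ω i).1 * (q (ω i).1 (ω i).2.1 * r (ω i).1 (ω i).2.2) else 0) ≤ η) :
    ∃ u : Fin n → U, (∀ i, 0 < w (u i)) ∧
      ∑ x : Fin n → X, ∑ y : Fin n → Y, (if bad fun i => (u i, x i, y i) then
        (∏ i, q (u i) (x i)) * ∏ i, r (u i) (y i) else 0) ≤ η := by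
  have hW := prod_mem_stdSimplex_pi (n := n) fun _ => hw
  rw [sum_fun_triple] at h
  simp only [Finset.prod_mul_distrib] at h
  by_contra! hcon
  have key : ∀ u : Fin n → U, 0 < ∏ i, w (u i) →
      η < ∑ x : Fin n → X, ∑ y : Fin n → Y, (if bad fun i => (u i, x i, y i) then
        (∏ i, q (u i) (x i)) * ∏ i, r (u i) (y i) else 0) := fun u hu => hcon u fun i =>
    (hw.1 _).lt_of_ne' fun h0 => hu.ne' (Finset.prod_eq_zero (Finset.mem_univ i) h0)
  refine absurd h (not_le.2 ?_)
  calc η = ∑ u : Fin n → U, (∏ i, w (u i)) * η := by rw [← Finset.sum_mul, hW.2, one_mul]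
    _ < ∑ u : Fin n → U, (∏ i, w (u i)) * ∑ x : Fin n → X, ∑ y : Fin n → Y,
        (if bad fun i => (u i, x i, y i) then
          (∏ i, q (u i) (x i)) * ∏ i, r (u i) (y i) else 0) := by
        refine Finset.sum_lt_sum (fun u _ => ?_) ?_
        · rcases (hW.1 u).eq_or_lt with h0 | h0
          · simp only at h0
            rw [← h0, zero_mul, zero_mul]
          · exact mul_le_mul_of_nonneg_left (key u h0).le h0.le
        · obtain ⟨u, -, hu⟩ := Finset.exists_ne_zero_of_sum_ne_zero (hW.2.trans_ne one_ne_zero)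
          have hu' := (hW.1 u).lt_of_ne' hu
          exact ⟨u, Finset.mem_univ u, mul_lt_mul_of_pos_left (key u hu') hu'⟩
    _ = _ := by simp only [Finset.mul_sum, mul_ite, mul_zero]

/-! ### Achievability: the nearly complete subgraphs -/

lemma HasLogRateGE.mono {c c' n : ℕ} {R δ : ℝ} (h : HasLogRateGE c n R δ) (hc : c ≤ c') :
    HasLogRateGE c' n R δ :=
  ⟨h.1.trans_le hc, h.2.trans (div_le_div_of_nonneg_right
    (Real.logb_le_logb_of_le one_lt_two (by exact_mod_cast h.1) (by exact_mod_cast hc))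
    (Nat.cast_nonneg n))⟩

open Classical in
/-- The subgraph induced by sets `A` and `B` of typical sequences is nearly complete as soon as the
sizes of `A`, `B` and of the sets of jointly typical partners are right. -/
lemma exists_isNearlyComplete_of_finset {X Y : Type*} [Fintype X] [Fintype Y] {P : X × Y → ℝ}
    {ε₁ ε₂ lam RX RY δ : ℝ} {n : ℕ} {A : Finset (Fin n → X)} {B : Finset (Fin n → Y)}
    (hA : ∀ x ∈ A, x ∈ typicalSet (margFst P) ε₁ n) (hB : ∀ y ∈ B, y ∈ typicalSet (margSnd P) ε₂ n)
    (hAR : HasLogRate A.card n RX δ) (hBR : HasLogRate B.card n RY δ)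
    (hAdeg : ∀ x ∈ A, HasLogRateGE
      (B.filter fun y => (fun i => (x i, y i)) ∈ typicalSet P lam n).card n RY δ)
    (hBdeg : ∀ y ∈ B, HasLogRateGE
      (A.filter fun x => (fun i => (x i, y i)) ∈ typicalSet P lam n).card n RX δ) :
    ∃ Γ : (typicalityGraph P ε₁ ε₂ lam n).Subgraph, IsNearlyComplete Γ n RX RY δ := by
  let Γ : (typicalityGraph P ε₁ ε₂ lam n).Subgraph :=
    (⊤ : (typicalityGraph P ε₁ ε₂ lam n).Subgraph).induce
      {v | Sum.elim (fun x => x.1 ∈ A) (fun y => y.1 ∈ B) v}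
  have hleft : (leftVerts Γ).ncard = A.card := by
    rw [← Set.ncard_image_of_injective _ Subtype.val_injective, ← Set.ncard_coe_finset]
    congr 1
    ext x
    exact ⟨by rintro ⟨x, hx, rfl⟩; exact hx, fun hx => ⟨⟨x, hA x hx⟩, hx, rfl⟩⟩
  have hright : (rightVerts Γ).ncard = B.card := by
    rw [← Set.ncard_image_of_injective _ Subtype.val_injective, ← Set.ncard_coe_finset]
    congr 1
    ext y
    exact ⟨by rintro ⟨y, hy, rfl⟩; exact hy, fun hy => ⟨⟨y, hB y hy⟩, hy, rfl⟩⟩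
  refine ⟨Γ, hleft ▸ hAR, hright ▸ hBR, fun x hx => (hAdeg x.1 hx).mono ?_,
    fun y hy => (hBdeg y.1 hy).mono ?_⟩
  · rw [subDegree, neighborSet_inl, Set.ncard_image_of_injective _ Sum.inr_injective,
      ← Set.ncard_image_of_injective _ Subtype.val_injective, ← Set.ncard_coe_finset]
    refine Set.ncard_le_ncard (fun y hy => ?_) (Set.toFinite _)
    obtain ⟨hyB, hxy⟩ := Finset.mem_filter.1 (Finset.mem_coe.1 hy)
    exact ⟨⟨y, hB y hyB⟩, ⟨hx, hyB, hxy⟩, rfl⟩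
  · rw [subDegree, neighborSet_inr, Set.ncard_image_of_injective _ Sum.inl_injective,
      ← Set.ncard_image_of_injective _ Subtype.val_injective, ← Set.ncard_coe_finset]
    refine Set.ncard_le_ncard (fun x hx => ?_) (Set.toFinite _)
    obtain ⟨hxA, hxy⟩ := Finset.mem_filter.1 (Finset.mem_coe.1 hx)
    exact ⟨⟨x, hA x hxA⟩, ⟨hy, hxA, hxy⟩, rfl⟩

/-- A sequence of positive probability with all its statistics right is typical. -/
lemma mem_typicalSet_of_deviation_le {A : Type*} {P : A → ℝ} {ε : ℝ} {n : ℕ}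
    (hn : 0 < n) {x : Fin n → A} (hpos : ∀ i, 0 < P (x i))
    (h : ∀ a, |∑ i, Set.indicator {a} (fun _ => (1 : ℝ)) (x i) - n * P a| ≤ n * ε) :
    x ∈ typicalSet P ε n := by
  have hn' : (0 : ℝ) < n := by exact_mod_cast hn
  refine ⟨fun a => ?_, fun a ha => ?_⟩
  · classical
    have h1 : (letterCount a x : ℝ) / n - P a = (letterCount a x - n * P a) / n := by
      field_simp
    rw [h1, abs_div, Nat.abs_cast, div_le_iff₀ hn', mul_comm ε, letterCount_eq_sum]
    simpa only [Set.indicator_apply, Set.mem_singleton_iff] using h a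
  · have : {i : Fin n | x i = a} = ∅ :=
      Set.eq_empty_of_forall_notMem fun i hi => (hpos i).ne' ((show x i = a from hi) ▸ ha)
    rw [letterCount, this, Set.ncard_empty]

/-- The information density of the sequence bounds its probability from both sides. -/
lemma rpow_le_prod_and_prod_le_rpow {n : ℕ} {p : Fin n → ℝ} {R ε : ℝ} (hp : ∀ i, 0 < p i)
    (h : |∑ i, -Real.logb 2 (p i) - n * R| ≤ n * ε) :
    (2 : ℝ) ^ (-(n * (R + ε))) ≤ ∏ i, p i ∧ ∏ i, p i ≤ (2 : ℝ) ^ (-(n * (R - ε))) := by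
  have hprod : 0 < ∏ i, p i := Finset.prod_pos fun i _ => hp i
  have hlog : Real.logb 2 (∏ i, p i) = ∑ i, Real.logb 2 (p i) :=
    Real.logb_prod _ _ fun i _ => (hp i).ne'
  rw [← Real.le_logb_iff_rpow_le one_lt_two hprod, ← Real.logb_le_iff_le_rpow one_lt_two hprod,
    hlog]
  rw [Finset.sum_neg_distrib, abs_le] at h
  constructor <;> linarith

/-- A set of half of the mass of a distribution contains almost `2 ^ (n * R)` points, if all of them
have probability about `2 ^ (-n * R)`. -/
lemma hasLogRateGE_of_half_le_sum {S : Type*} {A : Finset S} {a : S → ℝ} {n : ℕ} (hn : 0 < n)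
    {R ε : ℝ} (ha : ∀ x ∈ A, a x ≤ (2 : ℝ) ^ (-(n * (R - ε)))) (h : 1 / 2 ≤ ∑ x ∈ A, a x) :
    HasLogRateGE A.card n R (ε + 1 / n) := by
  have hn' : (0 : ℝ) < n := by exact_mod_cast hn
  have hpos : 0 < A.card := by
    rw [Finset.card_pos]
    by_contra h0
    rw [Finset.not_nonempty_iff_eq_empty] at h0
    norm_num [h0] at h
  have hpos' : (0 : ℝ) < A.card := by exact_mod_cast hpos
  refine ⟨hpos, ?_⟩
  have h1 := h.trans (Finset.sum_le_card_nsmul _ _ _ ha)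
  rw [nsmul_eq_mul] at h1
  have h2 := Real.logb_le_logb_of_le one_lt_two (by norm_num) h1
  rw [Real.logb_mul hpos'.ne' (Real.rpow_pos_of_pos two_pos _).ne',
    Real.logb_rpow two_pos (by norm_num), one_div, Real.logb_inv,
    Real.logb_self_eq_one one_lt_two] at h2
  rw [le_div_iff₀ hn']
  have h3 : (R - (ε + 1 / n)) * n = n * (R - ε) - 1 := by field_simp; ring
  linarith

lemma hasLogRate_of_half_le_sum {S : Type*} [Fintype S] {A : Finset S} {a : S → ℝ}
    (hstd : a ∈ stdSimplex ℝ S) {n : ℕ} (hn : 0 < n) {R ε : ℝ}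
    (ha : ∀ x ∈ A, a x ≤ (2 : ℝ) ^ (-(n * (R - ε))))
    (ha' : ∀ x ∈ A, (2 : ℝ) ^ (-(n * (R + ε))) ≤ a x) (h : 1 / 2 ≤ ∑ x ∈ A, a x) :
    HasLogRate A.card n R (ε + 1 / n) := by
  have hn' : (0 : ℝ) < n := by exact_mod_cast hn
  obtain ⟨hpos, hge⟩ := hasLogRateGE_of_half_le_sum hn ha h
  have hpos' : (0 : ℝ) < A.card := by exact_mod_cast hpos
  refine ⟨hpos, abs_le.2 ⟨by linarith, ?_⟩⟩
  have h1 := (Finset.card_nsmul_le_sum _ _ _ ha').trans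
    ((Finset.sum_le_sum_of_subset_of_nonneg (Finset.subset_univ A) fun x _ _ => hstd.1 x).trans_eq
      hstd.2)
  rw [nsmul_eq_mul] at h1
  have h2 := Real.logb_le_logb_of_le one_lt_two
    (mul_pos hpos' (Real.rpow_pos_of_pos two_pos _)) h1
  rw [Real.logb_mul hpos'.ne' (Real.rpow_pos_of_pos two_pos _).ne',
    Real.logb_rpow two_pos (by norm_num), Real.logb_one] at h2
  have h3 : Real.logb 2 A.card / n ≤ R + ε := by
    rw [div_le_iff₀ hn']
    linarith
  have h4 : (0 : ℝ) < 1 / n := by positivity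
  linarith

/-- The statistics of a triple `(u, x, y)` of letters that enter the definition of the typicality
graph or determine probabilities given `u`: the indicators of pairs and of single letters, and the
information densities of `x` and `y` given `u`. -/
noncomputable def letterStat {U X Y : Type*} (q : U → X → ℝ) (r : U → Y → ℝ) :
    (X × Y) ⊕ X ⊕ Y ⊕ Bool → U × X × Y → ℝ
  | .inl z, v => Set.indicator {z} (fun _ => 1) v.2
  | .inr (.inl x), v => Set.indicator {x} (fun _ => 1) v.2.1
  | .inr (.inr (.inl y)), v => Set.indicator {y} (fun _ => 1) v.2.2
  | .inr (.inr (.inr false)), v => -Real.logb 2 (q v.1 v.2.1)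
  | .inr (.inr (.inr true)), v => -Real.logb 2 (r v.1 v.2.2)

/-- The means of the statistics `letterStat`. -/
def letterStatMean {X Y : Type*} [Fintype X] [Fintype Y] (P : X × Y → ℝ) (RX RY : ℝ) :
    (X × Y) ⊕ X ⊕ Y ⊕ Bool → ℝ
  | .inl z => P z
  | .inr (.inl x) => margFst P x
  | .inr (.inr (.inl y)) => margSnd P y
  | .inr (.inr (.inr false)) => RX
  | .inr (.inr (.inr true)) => RY

/-- The tolerances for the statistics `letterStat`. -/
def letterStatTol {X Y : Type*} (ε₁ ε₂ lam : ℕ → ℝ) : (X × Y) ⊕ X ⊕ Y ⊕ Bool → ℕ → ℝ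
  | .inl _ => lam
  | .inr (.inl _) => ε₁
  | .inr (.inr (.inl _)) => ε₂
  | .inr (.inr (.inr _)) => lam

lemma sum_mul_letterStat {U X Y : Type*} [Fintype U] [Fintype X] [Fintype Y] {P : X × Y → ℝ}
    {w : U → ℝ} {q : U → X → ℝ} {r : U → Y → ℝ} (hq : ∀ u, q u ∈ stdSimplex ℝ X)
    (hr : ∀ u, r u ∈ stdSimplex ℝ Y) (hmix : ∀ x y, P (x, y) = ∑ u, w u * (q u x * r u y))
    (j : (X × Y) ⊕ X ⊕ Y ⊕ Bool) :
    ∑ v : U × X × Y, w v.1 * (q v.1 v.2.1 * r v.1 v.2.2) * letterStat q r j v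
      = letterStatMean P (∑ u, w u * entropy (q u)) (∑ u, w u * entropy (r u)) j := by
  classical
  -- The statistics other than the information densities depend on the pair only.
  have hpair : ∀ f : X × Y → ℝ,
      ∑ v : U × X × Y, w v.1 * (q v.1 v.2.1 * r v.1 v.2.2) * f v.2 = ∑ z, P z * f z := by
    intro f
    rw [Fintype.sum_prod_type, Finset.sum_comm]
    refine Finset.sum_congr rfl fun z _ => ?_
    change ∑ u, w u * (q u z.1 * r u z.2) * f z = P z * f z
    rw [← Finset.sum_mul, ← hmix]
  have hX : ∀ u, ∑ z : X × Y, w u * (q u z.1 * r u z.2) * -Real.logb 2 (q u z.1)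
      = w u * entropy (q u) := by
    intro u
    have : ∀ x y, w u * (q u x * r u y) * -Real.logb 2 (q u x)
        = r u y * (w u * -(q u x * Real.logb 2 (q u x))) := fun x y => by ring
    simp only [Fintype.sum_prod_type, this, ← Finset.sum_mul, (hr u).2, one_mul, ← Finset.mul_sum,
      Finset.sum_neg_distrib, entropy]
  have hY : ∀ u, ∑ z : X × Y, w u * (q u z.1 * r u z.2) * -Real.logb 2 (r u z.2)
      = w u * entropy (r u) := by
    intro u
    have : ∀ x y, w u * (q u x * r u y) * -Real.logb 2 (r u y)
        = q u x * (w u * -(r u y * Real.logb 2 (r u y))) := fun x y => by ring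
    simp only [Fintype.sum_prod_type_right, this, ← Finset.sum_mul, (hq u).2, one_mul,
      ← Finset.mul_sum, Finset.sum_neg_distrib, entropy]
  rcases j with z | x | y | (_ | _)
  · refine (hpair (Set.indicator {z} fun _ => 1)).trans ?_
    simp [letterStatMean, Set.indicator_apply]
  · refine (hpair fun z => Set.indicator {x} (fun _ => 1) z.1).trans ?_
    simpa [pushforward, letterStatMean, Set.indicator_apply] using congrFun (pushforward_fst P) x
  · refine (hpair fun z => Set.indicator {y} (fun _ => 1) z.2).trans ?_
    simpa [pushforward, letterStatMean, Set.indicator_apply] using congrFun (pushforward_snd P) y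
  · rw [Fintype.sum_prod_type]
    exact Finset.sum_congr rfl fun u _ => hX u
  · rw [Fintype.sum_prod_type]
    exact Finset.sum_congr rfl fun u _ => hY u

/-- Random coding: with `U` drawn independently from `w` and fixed, the sequences drawn from the
factors `q` and `r` of the mixture span, after pruning, a nearly complete subgraph. -/
lemma IsProductMixture.eventually_exists_isNearlyComplete {X Y : Type*} [Fintype X] [Fintype Y]
    {P : X × Y → ℝ} {RX RY : ℝ} (h : IsProductMixture P RX RY) {ε₁ ε₂ lam : ℕ → ℝ}
    (hε₁ : DeltaConvention ε₁) (hε₂ : DeltaConvention ε₂) (hlam : DeltaConvention lam) :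
    ∀ᶠ n in atTop, ∃ Γ : (typicalityGraph P (ε₁ n) (ε₂ n) (lam n) n).Subgraph,
      IsNearlyComplete Γ n RX RY (lam n + 1 / n) := by
  classical
  obtain ⟨U, _, w, q, r, hw, hq, hr, hmix, rfl, rfl⟩ := h
  set RX := ∑ u, w u * entropy (q u)
  set RY := ∑ u, w u * entropy (r u)
  have hQ : (fun v : U × X × Y => w v.1 * (q v.1 v.2.1 * r v.1 v.2.2)) ∈
      stdSimplex ℝ (U × X × Y) := by
    refine ⟨fun v => mul_nonneg (hw.1 _) (mul_nonneg ((hq _).1 _) ((hr _).1 _)), ?_⟩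
    rw [Fintype.sum_prod_type, ← hw.2]
    refine Finset.sum_congr rfl fun u _ => ?_
    simp only [← Finset.mul_sum]
    rw [(prod_mem_stdSimplex (hq u) (hr u)).2, mul_one]
  have htol : ∀ j : (X × Y) ⊕ X ⊕ Y ⊕ Bool, DeltaConvention (letterStatTol ε₁ ε₂ lam j) := by
    rintro (z | x | y | (_ | _))
    exacts [hlam, hε₁, hε₂, hlam, hlam]
  have hev := eventually_sum_prod_exists_deviation_le hQ (letterStat q r)
    (sum_mul_letterStat hq hr hmix) htol (show (0 : ℝ) < 1 / 16 by norm_num)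
  filter_upwards [hev, eventually_gt_atTop 0] with n hsum hn
  -- A triple is bad if some statistic deviates from its mean by more than its tolerance.
  obtain ⟨badTriple, hbad⟩ : ∃ bad : (Fin n → U × X × Y) → Prop, bad = fun ω =>
      ∃ j, n * letterStatTol ε₁ ε₂ lam j n <
        |∑ i, letterStat q r j (ω i) - n * letterStatMean P RX RY j| := ⟨_, rfl⟩
  obtain ⟨u, hu, hfib⟩ := exists_fiber_sum_le hw badTriple (by subst hbad; convert hsum)
  -- Given `u`, the sequences `x` and `y` are independent, with the following distributions.
  have ha : (fun x : Fin n → X => ∏ i, q (u i) (x i)) ∈ stdSimplex ℝ (Fin n → X) :=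
    prod_mem_stdSimplex_pi fun i => hq (u i)
  have hb : (fun y : Fin n → Y => ∏ i, r (u i) (y i)) ∈ stdSimplex ℝ (Fin n → Y) :=
    prod_mem_stdSimplex_pi fun i => hr (u i)
  let bad : (Fin n → X) → (Fin n → Y) → Prop := fun x y =>
    badTriple fun i => (u i, x i, y i)
  obtain ⟨A, B, hA, hB, hAsum, hBsum, hAdeg, hBdeg⟩ := exists_finset_good_pairs ha hb bad hfib
  have hApos : ∀ x ∈ A, ∀ i, 0 < q (u i) (x i) := fun x hx i =>
    ((hq _).1 _).lt_of_ne' fun h0 => (hA x hx).ne' (Finset.prod_eq_zero (Finset.mem_univ i) h0)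
  have hBpos : ∀ y ∈ B, ∀ i, 0 < r (u i) (y i) := fun y hy i =>
    ((hr _).1 _).lt_of_ne' fun h0 => (hB y hy).ne' (Finset.prod_eq_zero (Finset.mem_univ i) h0)
  have hPnn : ∀ z, 0 ≤ P z := fun z => by
    rw [← Prod.mk.eta (p := z), hmix]
    exact Finset.sum_nonneg fun u _ =>
      mul_nonneg (hw.1 u) (mul_nonneg ((hq u).1 _) ((hr u).1 _))
  have hPpos : ∀ x ∈ A, ∀ y ∈ B, ∀ i, 0 < P (x i, y i) := fun x hx y hy i => by
    rw [hmix]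
    exact Finset.sum_pos'
      (fun u _ => mul_nonneg (hw.1 u) (mul_nonneg ((hq u).1 _) ((hr u).1 _)))
      ⟨u i, Finset.mem_univ _, mul_pos (hu i) (mul_pos (hApos x hx i) (hBpos y hy i))⟩
  have hgood : ∀ {x y}, ¬bad x y → ∀ j, |∑ i, letterStat q r j (u i, x i, y i)
      - n * letterStatMean P RX RY j| ≤ n * letterStatTol ε₁ ε₂ lam j n := fun h j => by
    by_contra! hj
    exact h (by simp only [bad, hbad]; exact ⟨j, hj⟩)
  have hjoint : ∀ x ∈ A, ∀ y ∈ B, ¬bad x y →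
      (fun i => (x i, y i)) ∈ typicalSet P (lam n) n := fun x hx y hy hxy =>
    mem_typicalSet_of_deviation_le hn (hPpos x hx y hy) fun z => hgood hxy (.inl z)
  -- The statistics of `x` alone are read off from any good partner of `x`, and likewise for `y`.
  have hApartner : ∀ x ∈ A, ∃ y ∈ B, ¬bad x y := fun x hx => by
    obtain ⟨y, hy, -⟩ := Finset.exists_ne_zero_of_sum_ne_zero
      ((show (0 : ℝ) < 1 / 2 by norm_num).trans_le (hAdeg x hx)).ne'
    exact ⟨y, Finset.mem_filter.1 hy⟩
  have hBpartner : ∀ y ∈ B, ∃ x ∈ A, ¬bad x y := fun y hy => by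
    obtain ⟨x, hx, -⟩ := Finset.exists_ne_zero_of_sum_ne_zero
      ((show (0 : ℝ) < 1 / 2 by norm_num).trans_le (hBdeg y hy)).ne'
    exact ⟨x, Finset.mem_filter.1 hx⟩
  have hAprob : ∀ x ∈ A, (2 : ℝ) ^ (-(n * (RX + lam n))) ≤ ∏ i, q (u i) (x i) ∧
      ∏ i, q (u i) (x i) ≤ (2 : ℝ) ^ (-(n * (RX - lam n))) := fun x hx => by
    obtain ⟨y, -, hxy⟩ := hApartner x hx
    exact rpow_le_prod_and_prod_le_rpow (hApos x hx) (hgood hxy (.inr (.inr (.inr false))))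
  have hBprob : ∀ y ∈ B, (2 : ℝ) ^ (-(n * (RY + lam n))) ≤ ∏ i, r (u i) (y i) ∧
      ∏ i, r (u i) (y i) ≤ (2 : ℝ) ^ (-(n * (RY - lam n))) := fun y hy => by
    obtain ⟨x, -, hxy⟩ := hBpartner y hy
    exact rpow_le_prod_and_prod_le_rpow (hBpos y hy) (hgood hxy (.inr (.inr (.inr true))))
  refine exists_isNearlyComplete_of_finset (A := A) (B := B) (fun x hx => ?_) (fun y hy => ?_)
    (hasLogRate_of_half_le_sum ha hn (fun x hx => (hAprob x hx).2) (fun x hx => (hAprob x hx).1)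
      hAsum)
    (hasLogRate_of_half_le_sum hb hn (fun y hy => (hBprob y hy).2) (fun y hy => (hBprob y hy).1)
      hBsum) (fun x hx => ?_) (fun y hy => ?_)
  · obtain ⟨y, hy, hxy⟩ := hApartner x hx
    exact mem_typicalSet_of_deviation_le hn
      (fun i => margFst_pos_of_pos hPnn (hPpos x hx y hy i)) fun a => hgood hxy (.inr (.inl a))
  · obtain ⟨x, hx, hxy⟩ := hBpartner y hy
    exact mem_typicalSet_of_deviation_le hn
      (fun i => margSnd_pos_of_pos hPnn (hPpos x hx y hy i))
      fun b => hgood hxy (.inr (.inr (.inl b)))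
  · refine (hasLogRateGE_of_half_le_sum hn
      (fun y hy => (hBprob y (Finset.mem_filter.1 hy).1).2) (hAdeg x hx)).mono
      (Finset.card_le_card fun y hy => ?_)
    obtain ⟨hy1, hy2⟩ := Finset.mem_filter.1 hy
    exact Finset.mem_filter.2 ⟨hy1, hjoint x hx y hy1 hy2⟩
  · refine (hasLogRateGE_of_half_le_sum hn
      (fun x hx => (hAprob x (Finset.mem_filter.1 hx).1).2) (hBdeg y hy)).mono
      (Finset.card_le_card fun x hx => ?_)
    obtain ⟨hx1, hx2⟩ := Finset.mem_filter.1 hx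
    exact Finset.mem_filter.2 ⟨hx1, hjoint x hx1 y hy hx2⟩

lemma markovRegion_subset_nearlyCompleteRates {X Y : Type*} [Fintype X] [Fintype Y] {P : X × Y → ℝ}
    (hP : P ∈ stdSimplex ℝ (X × Y)) {ε₁ ε₂ lam : ℕ → ℝ} (hε₁ : DeltaConvention ε₁)
    (hε₂ : DeltaConvention ε₂) (hlam : DeltaConvention lam) :
    markovRegion P ⊆ nearlyCompleteRates P ε₁ ε₂ lam := by
  intro R hR
  obtain ⟨a, b, ha, hb, hmix⟩ := exists_isProductMixture_of_mem_markovRegion hP hR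
  refine ⟨fun n => Classical.epsilon fun Γ => IsNearlyComplete Γ n R.1 R.2 (lam n + 1 / n),
    fun n => lam n + 1 / n, ?_, ((hmix.mono hR.1 ha hR.2.1 hb).eventually_exists_isNearlyComplete
      hε₁ hε₂ hlam).mono fun n hn => Classical.epsilon_spec hn⟩
  simpa using hlam.1.add tendsto_one_div_atTop_nhds_zero_nat

end TypicalityGraph

theorem mainTheorem1 {X Y : Type*} [Fintype X] [Fintype Y] (P : X × Y → ℝ)
    (hP : P ∈ stdSimplex ℝ (X × Y)) (ε₁ ε₂ lam : ℕ → ℝ)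
    (hε₁ : TypicalityGraph.DeltaConvention ε₁) (hε₂ : TypicalityGraph.DeltaConvention ε₂)
    (hlam : TypicalityGraph.DeltaConvention lam) :
    TypicalityGraph.markovRegion P ⊆ TypicalityGraph.nearlyCompleteRates P ε₁ ε₂ lam ∧
    ∀ (RX RY : ℝ) (δ : ℕ → ℝ)
      (Γ : ∀ n, (TypicalityGraph.typicalityGraph P (ε₁ n) (ε₂ n) (lam n) n).Subgraph),
      TypicalityGraph.IsNearlyCompleteSeq P ε₁ ε₂ lam Γ RX RY δ →
      Tendsto (fun n : ℕ => δ n * Real.logb 2 n) atTop (𝓝 0) →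
      (RX, RY) ∈ TypicalityGraph.markovRegion P :=
  ⟨TypicalityGraph.markovRegion_subset_nearlyCompleteRates hP hε₁ hε₂ hlam,
    fun _ _ _ _ hΓ _ => hΓ.mem_markovRegion hP hlam.1⟩
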